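/- **Theorem 4.2 (global convergence, discrete-time mixed $\mathcal H_2/\mathcal H_\infty$ design).** Let $A\in\mathbb R^{m\times m}$, $B\in\mathbb R^{m\times d}$, $C\in\mathbb R^{l\times m}$, $D\in\mathbb R^{m\times n}$, let $R\in\mathbb R^{d\times d}$ be symmetric positive definite and let $\gamma>0$. For a gain $K\in\mathbb R^{d\times m}$ let $\mathcal T(K)(z)=(C^\top C+K^\top RK)^{1/2}(zI-(A-BK))^{-1}D$ and $$\mathcal K=\{K:\ \rho(A-BK)<1,\ \|\mathcal T(K)\|_\infty<\gamma\},\qquad \|G\|_\infty=\sup_{\theta\in[0,2\pi)}\sigma_{\max}\big(G(e^{i\theta})\big).$$ For a matrix $P$ put $\tilde P=P+PD(\gamma^2I-D^\top PD)^{-1}D^\top P$. For $K\in\mathcal K$ let $P_K\ge 0$ be the stabilizing solution of the Riccati equation $$(A-BK)^\top\tilde P_K(A-BK)+C^\top C+K^\top RK-P_K=0,$$ i.e. the solution with $I-\gamma^{-2}D^\top P_KD>0$ and $\rho\big((I-\gamma^{-2}P_KDD^\top)^{-\top}(A-BK)\big)<1$; it exists and is unique. Let $E_K=(R+B^\top\tilde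 P_KB)K-B^\top\tilde P_KA$. Let $K_0\in\mathcal K$, let $\eta>0$ be a constant stepsize, and let $(K_k)_{k\ge0}$ be generated from $K_0$ either by * natural policy gradient, $K_{k+1}=K_k-2\eta E_{K_k}$, with $2\eta\,\|R+B^\top\tilde P_{K_0}B\|\le 1$ (operator norm), or * Gauss–Newton, $K_{k+1}=K_k-2\eta(R+B^\top\tilde P_{K_k}B)^{-1}E_{K_k}$, with $\eta\le 1/2$. Then: 1. $K_k\in\mathcal K$ for all $k\ge0$. 2. There is a constant $c$ such that $\frac1N\sum_{k=0}^{N-1}\|E_{K_k}\|_F^2\le \frac cN$ for all $N\ge1$. 3. The matrices $P_{K_k}$ converge to some $P$, the gains $K_k$ converge to $K_\infty=(R+B^\top\tilde PB)^{-1}B^\top\tilde PA$, and $P$ solves the Riccati equation of $K_\infty$. 4. If $K^*\in\mathcal K$ satisfies $K^*=(R+B^\top\tilde P_{K^*}B)^{-1}B^\top\tilde P_{K^*}A$, then $K^*$ is a global optimum of the mixed design problem: it minimizes over $\mathcal K$ each of the costs $\operatorname{tr}(P_KDD^\top)$, $-\gamma^2\log\det(I-\gamma^{-2}P_KDD^\top)$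 and $\operatorname{tr}[D^\top P_K(I-\gamma^{-2}DD^\top P_K)^{-1}D]$; and $K_k\to K^*$. No controllability is assumed. -/

import Mathlib

open Matrix

section Norms

open scoped Matrix.Norms.L2Operator

/-- The operator norm (largest singular value) of a matrix, with respect to Euclidean norms. -/
noncomputable def opNorm {𝕜 : Type*} [RCLike 𝕜] {p q : ℕ} (M : Matrix (Fin p) (Fin q) 𝕜) : ℝ :=
  ‖M‖

end Norms

/-- The square of the Frobenius norm of a real matrix. -/
def frobSq {p q : ℕ} (M : Matrix (Fin p) (Fin q) ℝ) : ℝ :=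
  ∑ i, ∑ j, M i j ^ 2

/-- A real matrix viewed as a complex matrix. -/
noncomputable def toComplex {p q : ℕ} (M : Matrix (Fin p) (Fin q) ℝ) : Matrix (Fin p) (Fin q) ℂ :=
  M.map (algebraMap ℝ ℂ)

/-- Spectral radius of a real square matrix: the largest modulus of a complex eigenvalue. -/
noncomputable def specRad {p : ℕ} (M : Matrix (Fin p) (Fin p) ℝ) : ENNReal :=
  spectralRadius ℂ (toComplex M)

/-- The discrete-time `H∞` norm of a transfer function `G`: the supremum over the unit circle of
the largest singular value of `G (exp (i θ))`. It takes values in `[0, ∞]`. -/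
noncomputable def hInfNorm {p q : ℕ} (G : ℂ → Matrix (Fin p) (Fin q) ℂ) : ENNReal :=
  ⨆ θ ∈ Set.Ico (0 : ℝ) (2 * Real.pi),
    ENNReal.ofReal (opNorm (G (Complex.exp (Complex.I * (θ : ℂ)))))

/-- The data of a discrete-time mixed `H₂/H∞` design problem: state dimension `m`, control
dimension `d`, disturbance dimension `n`, output dimension `l`. -/
structure MixedDesign (m d n l : ℕ) where
  /-- state matrix -/
  A : Matrix (Fin m) (Fin m) ℝ
  /-- control matrix -/
  B : Matrix (Fin m) (Fin d) ℝ
  /-- state weight: the state cost is `Cᵀ C` -/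
  C : Matrix (Fin l) (Fin m) ℝ
  /-- disturbance matrix -/
  D : Matrix (Fin m) (Fin n) ℝ
  /-- control weight -/
  R : Matrix (Fin d) (Fin d) ℝ
  /-- robustness level -/
  γ : ℝ

namespace MixedDesign

variable {m d n l : ℕ} (S : MixedDesign m d n l)

/-- The closed-loop matrix `A - B K`. -/
def closedLoop (K : Matrix (Fin d) (Fin m) ℝ) : Matrix (Fin m) (Fin m) ℝ :=
  S.A - S.B * K

/-- The closed-loop weight `Cᵀ C + Kᵀ R K`. -/
def weight (K : Matrix (Fin d) (Fin m) ℝ) : Matrix (Fin m) (Fin m) ℝ :=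
  S.Cᵀ * S.C + Kᵀ * S.R * K

section Sqrt

open scoped MatrixOrder

/-- The positive semidefinite square root `(Cᵀ C + Kᵀ R K)^{1/2}`. -/
noncomputable def weightSqrt (K : Matrix (Fin d) (Fin m) ℝ) : Matrix (Fin m) (Fin m) ℝ :=
  CFC.sqrt (S.weight K)

end Sqrt

/-- The closed-loop transfer function
`𝒯(K)(z) = (Cᵀ C + Kᵀ R K)^{1/2} (z I - (A - B K))⁻¹ D`. -/
noncomputable def transfer (K : Matrix (Fin d) (Fin m) ℝ) (z : ℂ) : Matrix (Fin m) (Fin n) ℂ :=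
  toComplex (S.weightSqrt K) *
    (z • (1 : Matrix (Fin m) (Fin m) ℂ) - toComplex (S.closedLoop K))⁻¹ * toComplex S.D

/-- The feasible set `𝒦`: stabilizing gains for which the `H∞` norm of the closed-loop transfer
function is less than `γ`. -/
def feasible : Set (Matrix (Fin d) (Fin m) ℝ) :=
  {K | specRad (S.closedLoop K) < 1 ∧ hInfNorm (S.transfer K) < ENNReal.ofReal S.γ}

/-- `P̃ = P + P D (γ² I - Dᵀ P D)⁻¹ Dᵀ P`. -/
noncomputable def tilde (P : Matrix (Fin m) (Fin m) ℝ) : Matrix (Fin m) (Fin m) ℝ :=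
  P + P * S.D * (S.γ ^ 2 • (1 : Matrix (Fin n) (Fin n) ℝ) - S.Dᵀ * P * S.D)⁻¹ * S.Dᵀ * P

/-- The Riccati equation `(A - B K)ᵀ P̃ (A - B K) + Cᵀ C + Kᵀ R K - P = 0` of the gain `K`. -/
def Riccati (K : Matrix (Fin d) (Fin m) ℝ) (P : Matrix (Fin m) (Fin m) ℝ) : Prop :=
  (S.closedLoop K)ᵀ * S.tilde P * S.closedLoop K + S.Cᵀ * S.C + Kᵀ * S.R * K - P = 0

/-- `P` is a stabilizing solution of the Riccati equation of `K`: `P ≥ 0`, `P` solves the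
equation, `I - γ⁻² Dᵀ P D > 0`, and `(I - γ⁻² P D Dᵀ)⁻ᵀ (A - B K)` is stable. -/
structure IsStabilizingSolution (K : Matrix (Fin d) (Fin m) ℝ)
    (P : Matrix (Fin m) (Fin m) ℝ) : Prop where
  posSemidef : P.PosSemidef
  riccati : S.Riccati K P
  posDef : ((1 : Matrix (Fin n) (Fin n) ℝ) - (S.γ ^ 2)⁻¹ • (S.Dᵀ * P * S.D)).PosDef
  stable : specRad
    ((((1 : Matrix (Fin m) (Fin m) ℝ) - (S.γ ^ 2)⁻¹ • (P * S.D * S.Dᵀ))⁻¹)ᵀ * S.closedLoop K) < 1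

open Classical in
/-- `P_K`: the stabilizing solution of the Riccati equation of `K` (and `0` if there is none). -/
noncomputable def ricSol (K : Matrix (Fin d) (Fin m) ℝ) : Matrix (Fin m) (Fin m) ℝ :=
  if h : ∃ P, S.IsStabilizingSolution K P then h.choose else 0

/-- The matrix `R + Bᵀ P̃ B`. -/
noncomputable def hess (P : Matrix (Fin m) (Fin m) ℝ) : Matrix (Fin d) (Fin d) ℝ :=
  S.R + S.Bᵀ * S.tilde P * S.B

/-- The gain `(R + Bᵀ P̃ B)⁻¹ Bᵀ P̃ A`. -/
noncomputable def gain (P : Matrix (Fin m) (Fin m) ℝ) : Matrix (Fin d) (Fin m) ℝ :=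
  (S.hess P)⁻¹ * S.Bᵀ * S.tilde P * S.A

/-- `E_K = (R + Bᵀ P̃_K B) K - Bᵀ P̃_K A`. -/
noncomputable def E (K : Matrix (Fin d) (Fin m) ℝ) : Matrix (Fin d) (Fin m) ℝ :=
  S.hess (S.ricSol K) * K - S.Bᵀ * S.tilde (S.ricSol K) * S.A

/-- One natural policy gradient step `K ↦ K - 2 η E_K`. -/
noncomputable def npgStep (η : ℝ) (K : Matrix (Fin d) (Fin m) ℝ) : Matrix (Fin d) (Fin m) ℝ :=
  K - (2 * η) • S.E K

/-- One Gauss-Newton step `K ↦ K - 2 η (R + Bᵀ P̃_K B)⁻¹ E_K`. -/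
noncomputable def gnStep (η : ℝ) (K : Matrix (Fin d) (Fin m) ℝ) : Matrix (Fin d) (Fin m) ℝ :=
  K - (2 * η) • ((S.hess (S.ricSol K))⁻¹ * S.E K)

/-- The cost `tr (P_K D Dᵀ)`. -/
noncomputable def costTrace (K : Matrix (Fin d) (Fin m) ℝ) : ℝ :=
  (S.ricSol K * S.D * S.Dᵀ).trace

/-- The cost `-γ² log det (I - γ⁻² P_K D Dᵀ)`. -/
noncomputable def costLogDet (K : Matrix (Fin d) (Fin m) ℝ) : ℝ :=
  -S.γ ^ 2 * Real.log
    ((1 : Matrix (Fin m) (Fin m) ℝ) - (S.γ ^ 2)⁻¹ • (S.ricSol K * S.D * S.Dᵀ)).det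

/-- The cost `tr (Dᵀ P_K (I - γ⁻² D Dᵀ P_K)⁻¹ D)`. -/
noncomputable def costTraceInv (K : Matrix (Fin d) (Fin m) ℝ) : ℝ :=
  (S.Dᵀ * S.ricSol K *
    ((1 : Matrix (Fin m) (Fin m) ℝ) - (S.γ ^ 2)⁻¹ • (S.D * S.Dᵀ * S.ricSol K))⁻¹ * S.D).trace

/-- `K` lies in `𝒦` and minimizes over `𝒦` each of the three standard mixed-design costs. -/
def IsGlobalOptimum (K : Matrix (Fin d) (Fin m) ℝ) : Prop :=
  K ∈ S.feasible ∧ IsMinOn S.costTrace S.feasible K ∧ IsMinOn S.costLogDet S.feasible K ∧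
    IsMinOn S.costTraceInv S.feasible K

end MixedDesign

/-!
Everything rests on one observation: if `γ² I - Dᵀ P D > 0`, completing the square in the
disturbance `w` shows that `yᵀ P̃ y` is the maximum over `w` of
`(y + D w)ᵀ P (y + D w) - γ² |w|²` (`quadForm_add_mulVec_D`). Hence `P ↦ P̃` is monotone and lies
above its tangents (`quadForm_tilde_mono`, `quadForm_tilde_tangent`). The linear part of the tangent
of the Riccati operator at `P_K` is stable, so the stabilizing solution lies below every
supersolution (`IsStabilizingSolution.quadForm_le`); in particular it is unique.

Feasibility of a gain is equivalent to the existence of `X ≥ 0` with a strict dissipation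
inequality `StrictDissipation K X`. Necessity is the Kalman-Yakubovich-Popov lemma
(`exists_storage_of_frequency_inequality`): a separating hyperplane between the second moment
matrices `Z ≥ 0`, `tr Z = 1` and the stationary ones is a storage function, and a stationary
`Z = Y Yᵀ` decomposes, by diagonalizing a unitary matrix, into signals of a single frequency on
the unit circle (`eq_zero_of_frequency_inequality`). Given `X`, value iteration from `0` increases
to the stabilizing solution, bounded by `X`.

Write `Ric_K(P) = (A - B K)ᵀ P̃ (A - B K) + Cᵀ C + Kᵀ R K` (`ricOp`). A step `K' = K - N E_K` of
either iteration satisfies `Ric_{K'}(P_K) ≤ P_K - c E_Kᵀ E_K`. If `X` is a strict certificate for `K`, it fails to be one for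
`K'` by at most a multiple of `E_Kᵀ E_K`, so a convex combination of `P_K` and `X` certifies `K'`
(`sub_mul_mem_feasible`). The comparison principle then gives
`P_{K'} ≤ P_K - c E_Kᵀ E_K`. Summing this yields the `O(1/N)` rate; monotonicity yields the
convergence of `P_{K_k}`, and `E_{K_k} → 0` that of the gains (`IsDescentSequence.exists_limit`).

For two fixed points `X`, `Y` of policy improvement with worst-case closed loops `M`, `N`, the
Hamiltonian form of the Riccati equation gives `X - Y = Nᵀ (X - Y) M`. At a feasible fixed point
`M` is stable, while at the limit of a descent sequence the eigenvalues of `N` have modulus at most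
one, which forces `X = Y` (`eq_of_fixedPoints`). So every descent sequence converges to the feasible
fixed point, if there is one. Applied to policy iteration from an arbitrary feasible gain `K`, this
gives `P_{K*} ≤ P_K`, and the three costs are monotone in `P_K`.
-/

/-! ### Quadratic forms of real matrices -/

/-- The quadratic form `x ↦ xᵀ M x` of a real square matrix. -/
def quadForm {p : Type*} [Fintype p] (M : Matrix p p ℝ) (x : p → ℝ) : ℝ :=
  x ⬝ᵥ M *ᵥ x

section QuadForm

variable {p q : Type*} [Fintype p] [Fintype q]

theorem Matrix.IsSymm.dotProduct_mulVec_comm {M : Matrix p p ℝ} (hM : M.IsSymm) (x y : p → ℝ) :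
    x ⬝ᵥ M *ᵥ y = y ⬝ᵥ M *ᵥ x := by
  rw [dotProduct_mulVec, ← mulVec_transpose, hM.eq, dotProduct_comm]

theorem dotProduct_mulVec_transpose (M : Matrix p q ℝ) (x : p → ℝ) (y : q → ℝ) :
    x ⬝ᵥ M *ᵥ y = (Mᵀ *ᵥ x) ⬝ᵥ y := by
  rw [dotProduct_mulVec, mulVec_transpose]

theorem quadForm_add {M : Matrix p p ℝ} (hM : M.IsSymm) (x y : p → ℝ) :
    quadForm M (x + y) = quadForm M x + 2 * (x ⬝ᵥ M *ᵥ y) + quadForm M y := by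
  simp only [quadForm, mulVec_add, dotProduct_add, add_dotProduct]
  rw [hM.dotProduct_mulVec_comm y x]; ring

theorem quadForm_sub {M : Matrix p p ℝ} (hM : M.IsSymm) (x y : p → ℝ) :
    quadForm M (x - y) = quadForm M x - 2 * (x ⬝ᵥ M *ᵥ y) + quadForm M y := by
  simp only [quadForm, mulVec_sub, dotProduct_sub, sub_dotProduct]
  rw [hM.dotProduct_mulVec_comm y x]; ring

theorem quadForm_smul (M : Matrix p p ℝ) (c : ℝ) (x : p → ℝ) :
    quadForm M (c • x) = c ^ 2 * quadForm M x := by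
  simp only [quadForm, mulVec_smul, dotProduct_smul, smul_dotProduct, smul_eq_mul]; ring

theorem quadForm_matrix_add (M N : Matrix p p ℝ) (x : p → ℝ) :
    quadForm (M + N) x = quadForm M x + quadForm N x := by
  simp [quadForm, add_mulVec]

theorem quadForm_matrix_sub (M N : Matrix p p ℝ) (x : p → ℝ) :
    quadForm (M - N) x = quadForm M x - quadForm N x := by
  simp [quadForm, sub_mulVec]

theorem quadForm_matrix_smul (c : ℝ) (M : Matrix p p ℝ) (x : p → ℝ) :
    quadForm (c • M) x = c * quadForm M x := by
  simp [quadForm, smul_mulVec]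

theorem quadForm_one [DecidableEq p] (x : p → ℝ) : quadForm 1 x = x ⬝ᵥ x := by
  simp [quadForm]

theorem quadForm_congr (M : Matrix p p ℝ) (N : Matrix p q ℝ) (x : q → ℝ) :
    quadForm (Nᵀ * M * N) x = quadForm M (N *ᵥ x) := by
  rw [quadForm, quadForm, ← mulVec_mulVec, ← mulVec_mulVec, dotProduct_mulVec_transpose Nᵀ,
    transpose_transpose]

theorem dotProduct_self_nonneg (x : p → ℝ) : 0 ≤ x ⬝ᵥ x := by
  simpa using dotProduct_star_self_nonneg x

theorem posSemidef_iff_quadForm {M : Matrix p p ℝ} :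
    M.PosSemidef ↔ M.IsSymm ∧ ∀ x, 0 ≤ quadForm M x := by
  rw [posSemidef_iff_dotProduct_mulVec]
  simp [quadForm, IsHermitian, IsSymm]

theorem posDef_iff_quadForm {M : Matrix p p ℝ} :
    M.PosDef ↔ M.IsSymm ∧ ∀ x, x ≠ 0 → 0 < quadForm M x := by
  rw [posDef_iff_dotProduct_mulVec]
  simp [quadForm, IsHermitian, IsSymm]

theorem Matrix.PosSemidef.isSymm {M : Matrix p p ℝ} (hM : M.PosSemidef) : M.IsSymm :=
  (posSemidef_iff_quadForm.1 hM).1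

theorem Matrix.PosDef.isSymm {M : Matrix p p ℝ} (hM : M.PosDef) : M.IsSymm :=
  (posDef_iff_quadForm.1 hM).1

theorem Matrix.PosSemidef.quadForm_nonneg {M : Matrix p p ℝ} (hM : M.PosSemidef) (x : p → ℝ) :
    0 ≤ quadForm M x :=
  (posSemidef_iff_quadForm.1 hM).2 x

theorem Matrix.IsSymm.apply_eq_quadForm [DecidableEq p] {M : Matrix p p ℝ} (hM : M.IsSymm)
    (i j : p) : M i j = (quadForm M (Pi.single i 1 + Pi.single j 1) - quadForm M (Pi.single i 1) -
      quadForm M (Pi.single j 1)) / 2 := by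
  rw [quadForm_add hM]
  simp only [mulVec_single_one, single_one_dotProduct, col_apply]
  ring

theorem Matrix.IsSymm.ext_quadForm {M N : Matrix p p ℝ} (hM : M.IsSymm) (hN : N.IsSymm)
    (h : ∀ x, quadForm M x = quadForm N x) : M = N := by
  classical
  ext i j
  rw [hM.apply_eq_quadForm, hN.apply_eq_quadForm, h, h, h]

theorem exists_quadForm_le (M : Matrix p p ℝ) :
    ∃ c : ℝ, 0 ≤ c ∧ ∀ x, quadForm M x ≤ c * (x ⬝ᵥ x) := by
  refine ⟨∑ i, ∑ j, |M i j|, by positivity, fun x => ?_⟩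
  have key : ∀ i, x i ^ 2 ≤ x ⬝ᵥ x := fun i => by
    rw [dotProduct, pow_two]
    exact Finset.single_le_sum (f := fun i => x i * x i) (fun i _ => mul_self_nonneg _)
      (Finset.mem_univ i)
  have expand : quadForm M x = ∑ i, ∑ j, x i * (M i j * x j) := by
    simp only [quadForm, dotProduct, mulVec, Finset.mul_sum]
  rw [expand]
  simp only [Finset.sum_mul]
  refine Finset.sum_le_sum fun i _ => Finset.sum_le_sum fun j _ => ?_
  have h1 := key i
  have h2 := key j
  have h3 : x i * (M i j * x j) ≤ |M i j| * ((x i ^ 2 + x j ^ 2) / 2) := by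
    have : x i * (M i j * x j) = M i j * (x i * x j) := by ring
    rw [this]
    refine (le_abs_self _).trans ?_
    rw [abs_mul]
    refine mul_le_mul_of_nonneg_left ?_ (abs_nonneg _)
    rw [abs_le]
    constructor <;> nlinarith [sq_nonneg (x i - x j), sq_nonneg (x i + x j)]
  exact h3.trans (mul_le_mul_of_nonneg_left (by linarith) (abs_nonneg _))

/-- Young's inequality. -/
theorem two_mul_dotProduct_le {e : ℝ} (he : 0 < e) (x y : p → ℝ) :
    2 * (x ⬝ᵥ y) ≤ e * (x ⬝ᵥ x) + e⁻¹ * (y ⬝ᵥ y) := by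
  have h := mul_nonneg (inv_nonneg.2 he.le) (dotProduct_self_nonneg (e • x - y))
  simp only [sub_dotProduct, dotProduct_sub, smul_dotProduct, dotProduct_smul, smul_eq_mul] at h
  rw [dotProduct_comm y x] at h
  have h2 : e⁻¹ * (e * (e * (x ⬝ᵥ x)) - e * (x ⬝ᵥ y) - (e * (x ⬝ᵥ y) - y ⬝ᵥ y)) =
    e * (x ⬝ᵥ x) + e⁻¹ * (y ⬝ᵥ y) - 2 * (x ⬝ᵥ y) := by
    field_simp; ring
  linarith

theorem exists_two_mul_dotProduct_mulVec_le (M : Matrix p q ℝ) {e : ℝ} (he : 0 < e) :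
    ∃ c : ℝ, 0 ≤ c ∧ ∀ x y, 2 * (x ⬝ᵥ M *ᵥ y) ≤ e * (x ⬝ᵥ x) + c * (y ⬝ᵥ y) := by
  obtain ⟨c, hc, h⟩ := exists_quadForm_le (Mᵀ * M)
  refine ⟨e⁻¹ * c, by positivity, fun x y => (two_mul_dotProduct_le he _ _).trans ?_⟩
  have h1 := h y
  have h2 : quadForm (Mᵀ * M) y = (M *ᵥ y) ⬝ᵥ (M *ᵥ y) := by
    rw [quadForm, ← mulVec_mulVec, dotProduct_mulVec_transpose Mᵀ, transpose_transpose]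
  rw [h2] at h1
  have := mul_le_mul_of_nonneg_left h1 (inv_nonneg.2 he.le)
  rw [mul_assoc]; linarith

theorem continuous_quadForm_left (x : p → ℝ) : Continuous fun M : Matrix p p ℝ => quadForm M x := by
  unfold quadForm; fun_prop

theorem continuous_quadForm (M : Matrix p p ℝ) : Continuous (quadForm M) := by
  unfold quadForm; fun_prop

/-- A sequence of symmetric matrices converges as soon as its quadratic forms do. -/
theorem exists_tendsto_of_quadForm {M : ℕ → Matrix p p ℝ} (hM : ∀ k, (M k).IsSymm)
    (h : ∀ x, ∃ l, Filter.Tendsto (fun k => quadForm (M k) x) Filter.atTop (nhds l)) :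
    ∃ L : Matrix p p ℝ, L.IsSymm ∧ Filter.Tendsto M Filter.atTop (nhds L) := by
  classical
  choose l hl using h
  refine ⟨Matrix.of fun i j => (l (Pi.single i 1 + Pi.single j 1) - l (Pi.single i 1) -
      l (Pi.single j 1)) / 2, ?_, ?_⟩
  · ext i j
    simp only [transpose_apply, of_apply, add_comm]
    ring
  · refine tendsto_pi_nhds.2 fun i => tendsto_pi_nhds.2 fun j => ?_
    have : (fun k => M k i j) = fun k => (quadForm (M k) (Pi.single i 1 + Pi.single j 1) -
      quadForm (M k) (Pi.single i 1) - quadForm (M k) (Pi.single j 1)) / 2 :=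
      funext fun k => (hM k).apply_eq_quadForm i j
    rw [this]
    exact (((hl _).sub (hl _)).sub (hl _)).div_const 2

/-- A decreasing sequence of positive semidefinite matrices converges. -/
theorem exists_tendsto_of_antitone_quadForm {M : ℕ → Matrix p p ℝ} (hM : ∀ k, (M k).PosSemidef)
    (h : ∀ x k, quadForm (M (k + 1)) x ≤ quadForm (M k) x) :
    ∃ L : Matrix p p ℝ, L.PosSemidef ∧ Filter.Tendsto M Filter.atTop (nhds L) ∧
      ∀ x k, quadForm L x ≤ quadForm (M k) x := by
  have anti : ∀ x, Antitone fun k => quadForm (M k) x := fun x => antitone_nat_of_succ_le (h x)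
  obtain ⟨L, hL, hlim⟩ := exists_tendsto_of_quadForm (fun k => (hM k).isSymm) fun x =>
    ⟨_, tendsto_atTop_ciInf (anti x) ⟨0, by rintro _ ⟨k, rfl⟩; exact (hM k).quadForm_nonneg x⟩⟩
  have hq : ∀ x, Filter.Tendsto (fun k => quadForm (M k) x) Filter.atTop (nhds (quadForm L x)) :=
    fun x => ((continuous_quadForm_left x).tendsto L).comp hlim
  refine ⟨L, posSemidef_iff_quadForm.2 ⟨hL, fun x => ?_⟩, hlim, fun x k => ?_⟩
  · exact ge_of_tendsto' (hq x) fun k => (hM k).quadForm_nonneg x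
  · exact (anti x).le_of_tendsto (hq x) k

/-- An increasing bounded sequence of symmetric matrices converges. -/
theorem exists_tendsto_of_monotone_quadForm {M : ℕ → Matrix p p ℝ} (hM : ∀ k, (M k).IsSymm)
    (h : ∀ x k, quadForm (M k) x ≤ quadForm (M (k + 1)) x) {X : Matrix p p ℝ}
    (hX : ∀ x k, quadForm (M k) x ≤ quadForm X x) :
    ∃ L : Matrix p p ℝ, L.IsSymm ∧ Filter.Tendsto M Filter.atTop (nhds L) ∧
      (∀ x k, quadForm (M k) x ≤ quadForm L x) ∧ ∀ x, quadForm L x ≤ quadForm X x := by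
  have mono : ∀ x, Monotone fun k => quadForm (M k) x := fun x => monotone_nat_of_le_succ (h x)
  obtain ⟨L, hL, hlim⟩ := exists_tendsto_of_quadForm hM fun x =>
    ⟨_, tendsto_atTop_ciSup (mono x) ⟨_, by rintro _ ⟨k, rfl⟩; exact hX x k⟩⟩
  have hq : ∀ x, Filter.Tendsto (fun k => quadForm (M k) x) Filter.atTop (nhds (quadForm L x)) :=
    fun x => ((continuous_quadForm_left x).tendsto L).comp hlim
  exact ⟨L, hL, hlim, fun x k => (mono x).ge_of_tendsto (hq x) k, fun x =>
    le_of_tendsto' (hq x) (hX x)⟩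

end QuadForm

/-! ### Stable matrices -/

section ReIm

variable {p q : ℕ}

/-- The entrywise real part of a complex vector. -/
def vecRe {p : Type*} (v : p → ℂ) : p → ℝ := fun i => (v i).re

/-- The entrywise imaginary part of a complex vector. -/
def vecIm {p : Type*} (v : p → ℂ) : p → ℝ := fun i => (v i).im

/-- The real number `v* M v` for a complex vector `v` and a real symmetric matrix `M`, written
through real and imaginary parts. -/
def hermForm {p : Type*} [Fintype p] (M : Matrix p p ℝ) (v : p → ℂ) : ℝ :=
  quadForm M (vecRe v) + quadForm M (vecIm v)

theorem map_ofReal_mulVec_re {a b : Type*} [Fintype b] (M : Matrix a b ℝ) (v : b → ℂ) :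
    vecRe (M.map (algebraMap ℝ ℂ) *ᵥ v) = M *ᵥ vecRe v := by
  ext i; simp [vecRe, mulVec, dotProduct]

theorem map_ofReal_mulVec_im {a b : Type*} [Fintype b] (M : Matrix a b ℝ) (v : b → ℂ) :
    vecIm (M.map (algebraMap ℝ ℂ) *ᵥ v) = M *ᵥ vecIm v := by
  ext i; simp [vecIm, mulVec, dotProduct]

theorem vecRe_toComplex_mulVec (M : Matrix (Fin p) (Fin q) ℝ) (v : Fin q → ℂ) :
    vecRe (toComplex M *ᵥ v) = M *ᵥ vecRe v :=
  map_ofReal_mulVec_re M v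

theorem vecIm_toComplex_mulVec (M : Matrix (Fin p) (Fin q) ℝ) (v : Fin q → ℂ) :
    vecIm (toComplex M *ᵥ v) = M *ᵥ vecIm v :=
  map_ofReal_mulVec_im M v

theorem hermForm_smul {p : Type*} [Fintype p] {M : Matrix p p ℝ} (hM : M.IsSymm) (c : ℂ)
    (v : p → ℂ) : hermForm M (c • v) = ‖c‖ ^ 2 * hermForm M v := by
  have h1 : vecRe (c • v) = c.re • vecRe v - c.im • vecIm v := by
    ext i; simp [vecRe, vecIm]
  have h2 : vecIm (c • v) = c.re • vecIm v + c.im • vecRe v := by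
    ext i; simp [vecRe, vecIm]
  rw [hermForm, h1, h2, quadForm_sub hM, quadForm_add hM, hermForm, ← Complex.normSq_eq_norm_sq,
    Complex.normSq_apply]
  simp only [quadForm_smul, mulVec_smul, dotProduct_smul, smul_dotProduct, smul_eq_mul]
  rw [hM.dotProduct_mulVec_comm (vecRe v) (vecIm v)]
  ring

theorem hermForm_one_eq_sum {p : Type*} [Fintype p] [DecidableEq p] (v : p → ℂ) :
    hermForm 1 v = ∑ i, ‖v i‖ ^ 2 := by
  simp only [hermForm, quadForm_one, dotProduct, ← Finset.sum_add_distrib, vecRe, vecIm,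
    ← Complex.normSq_eq_norm_sq, Complex.normSq_apply]

theorem hermForm_one_pos {p : Type*} [Fintype p] [DecidableEq p] {v : p → ℂ} (hv : v ≠ 0) :
    0 < hermForm 1 v := by
  rw [hermForm_one_eq_sum]
  obtain ⟨i, hi⟩ := Function.ne_iff.1 hv
  exact Finset.sum_pos' (fun _ _ => by positivity)
    ⟨i, Finset.mem_univ i, by have : 0 < ‖v i‖ := norm_pos_iff.2 hi
                              positivity⟩

end ReIm

section Spectral

variable {p : ℕ}

theorem toComplex_pow (M : Matrix (Fin p) (Fin p) ℝ) (k : ℕ) :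
    toComplex (M ^ k) = toComplex M ^ k :=
  Matrix.map_pow M (algebraMap ℝ ℂ) k

theorem toComplex_smul (c : ℝ) (M : Matrix (Fin p) (Fin p) ℝ) :
    toComplex (c • M) = (c : ℂ) • toComplex M := by
  ext i j; simp [toComplex]

theorem mem_spectrum_iff_mulVec {M : Matrix (Fin p) (Fin p) ℂ} {z : ℂ} :
    z ∈ spectrum ℂ M ↔ ∃ v, v ≠ 0 ∧ M *ᵥ v = z • v := by
  rw [← spectrum_toLin', ← Module.End.hasEigenvalue_iff_mem_spectrum]
  constructor
  · intro h
    obtain ⟨v, hv⟩ := h.exists_hasEigenvector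
    exact ⟨v, hv.2, by simpa using hv.apply_eq_smul⟩
  · rintro ⟨v, hv, h⟩
    exact Module.End.hasEigenvalue_of_hasEigenvector
      (Module.End.hasEigenvector_iff.2 ⟨Module.End.mem_eigenspace_iff.2 (by simpa using h), hv⟩)

theorem specRad_lt_iff {M : Matrix (Fin p) (Fin p) ℝ} {r : NNReal} (hr : 0 < r) :
    specRad M < r ↔ ∀ (z : ℂ) (v : Fin p → ℂ), v ≠ 0 → toComplex M *ᵥ v = z • v → ‖z‖ < r := by
  constructor
  · intro h z v hv hz
    have h1 : (‖z‖₊ : ENNReal) ≤ specRad M :=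
      le_iSup₂ (f := fun (k : ℂ) (_ : k ∈ spectrum ℂ (toComplex M)) => (‖k‖₊ : ENNReal)) z
        (mem_spectrum_iff_mulVec.2 ⟨v, hv, hz⟩)
    have h2 := h1.trans_lt h
    exact_mod_cast h2
  · intro h
    have hfin : (spectrum ℂ (toComplex M)).Finite := Matrix.finite_spectrum _
    have hr' : (⊥ : ENNReal) < r := by simpa using hr
    rw [specRad, spectralRadius]
    have h2 : ⨆ k ∈ spectrum ℂ (toComplex M), (‖k‖₊ : ENNReal) =
        hfin.toFinset.sup fun k => (‖k‖₊ : ENNReal) := by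
      rw [Finset.sup_eq_iSup]; simp
    rw [h2, Finset.sup_lt_iff hr']
    intro z hz
    obtain ⟨v, hv, hz⟩ := mem_spectrum_iff_mulVec.1 (hfin.mem_toFinset.1 hz)
    have h3 := h z v hv hz
    have h4 : ‖z‖₊ < r := h3
    exact_mod_cast h4

theorem specRad_lt_one_iff {M : Matrix (Fin p) (Fin p) ℝ} :
    specRad M < 1 ↔ ∀ (z : ℂ) (v : Fin p → ℂ), v ≠ 0 → toComplex M *ᵥ v = z • v → ‖z‖ < 1 := by
  simpa using specRad_lt_iff (M := M) one_pos

section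

open scoped Matrix.Norms.L2Operator

theorem tendsto_pow_of_specRad_lt_one {M : Matrix (Fin p) (Fin p) ℝ} (hM : specRad M < 1) :
    Filter.Tendsto (fun k => M ^ k) Filter.atTop (nhds 0) := by
  have hG := spectrum.pow_nnnorm_pow_one_div_tendsto_nhds_spectralRadius (toComplex M)
  obtain ⟨r, hr1, hr2⟩ := ENNReal.lt_iff_exists_nnreal_btwn.1 hM
  have hr3 : r < 1 := by exact_mod_cast hr2
  have hev : ∀ᶠ k in Filter.atTop, ‖toComplex M ^ k‖ ≤ (r : ℝ) ^ k := by
    filter_upwards [hG.eventually_lt_const hr1, Filter.eventually_gt_atTop 0] with k hk hk0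
    have h1 := ENNReal.rpow_le_rpow hk.le (Nat.cast_nonneg k)
    rw [← ENNReal.rpow_mul, one_div, inv_mul_cancel₀ (by positivity), ENNReal.rpow_one,
      ENNReal.rpow_natCast] at h1
    exact_mod_cast h1
  have h0 : Filter.Tendsto (fun k => toComplex M ^ k) Filter.atTop (nhds 0) :=
    squeeze_zero_norm' hev (tendsto_pow_atTop_nhds_zero_of_lt_one r.2 (by exact_mod_cast hr3))
  refine tendsto_pi_nhds.2 fun i => tendsto_pi_nhds.2 fun j => ?_
  have h1 := tendsto_pi_nhds.1 (tendsto_pi_nhds.1 h0 i) j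
  have h2 := (Complex.continuous_re.tendsto _).comp h1
  refine h2.congr fun k => ?_
  rw [Function.comp_apply, ← toComplex_pow]
  simp [toComplex]

end

/-- Limits of stable matrices have all their eigenvalues in the closed unit disc. -/
theorem norm_eigenvalue_le_one_of_tendsto {M : ℕ → Matrix (Fin p) (Fin p) ℝ}
    {L : Matrix (Fin p) (Fin p) ℝ} (hM : ∀ k, specRad (M k) < 1)
    (hL : Filter.Tendsto M Filter.atTop (nhds L)) {z : ℂ} {v : Fin p → ℂ} (hv : v ≠ 0)
    (hz : toComplex L *ᵥ v = z • v) : ‖z‖ ≤ 1 := by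
  by_contra! hz1
  have hcont : Continuous fun N : Matrix (Fin p) (Fin p) ℝ => (toComplex N).charpoly.eval z := by
    simp only [Matrix.eval_charpoly]
    have : Continuous fun N : Matrix (Fin p) (Fin p) ℝ => toComplex N :=
      continuous_id.matrix_map (by exact Complex.continuous_ofReal)
    fun_prop
  have hlim := (hcont.tendsto L).comp hL
  have h0 : (toComplex L).charpoly.eval z = 0 :=
    Matrix.mem_spectrum_iff_isRoot_charpoly.1 (mem_spectrum_iff_mulVec.2 ⟨v, hv, hz⟩)
  rw [h0] at hlim
  -- the characteristic polynomial at `z` is a product of `p` factors of modulus at least `‖z‖ - 1`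
  have hbound : ∀ k, (‖z‖ - 1) ^ p ≤ ‖(toComplex (M k)).charpoly.eval z‖ := by
    intro k
    set f := (toComplex (M k)).charpoly with hf
    have hsplit : f.Splits := IsAlgClosed.splits f
    have hmonic : f.Monic := Matrix.charpoly_monic _
    have hcard : f.roots.card = p := by
      rw [← hsplit.natDegree_eq_card_roots, Matrix.charpoly_natDegree_eq_dim, Fintype.card_fin]
    rw [hsplit.eval_eq_prod_roots_of_monic hmonic, ← hcard]
    have hroot : ∀ w ∈ f.roots, ‖z‖ - 1 ≤ ‖z - w‖ := by
      intro w hw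
      obtain ⟨u, hu, huw⟩ := mem_spectrum_iff_mulVec.1
        (Matrix.mem_spectrum_iff_isRoot_charpoly.2 (Polynomial.isRoot_of_mem_roots hw))
      have h1 := specRad_lt_one_iff.1 (hM k) w u hu huw
      have h2 := norm_sub_norm_le z w
      linarith
    clear hcard
    generalize f.roots = s at hroot
    induction s using Multiset.induction_on with
    | empty => simp
    | cons a s ih =>
      simp only [Multiset.card_cons, Multiset.map_cons, Multiset.prod_cons, norm_mul, pow_succ']
      exact mul_le_mul (hroot a (Multiset.mem_cons_self a s))
        (ih fun w hw => hroot w (Multiset.mem_cons_of_mem hw)) (by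
          have : 0 ≤ ‖z‖ - 1 := by linarith
          positivity) (norm_nonneg _)
  have h1 := le_of_tendsto_of_tendsto' tendsto_const_nhds hlim.norm hbound
  have h2 : 0 < (‖z‖ - 1) ^ p := pow_pos (by linarith) p
  simp at h1
  linarith

/-- Lyapunov's criterion: a matrix is stable if it strictly decreases a nonnegative quadratic
form. -/
theorem specRad_lt_one_of_lyapunov {L X : Matrix (Fin p) (Fin p) ℝ} (hX : X.PosSemidef) {e : ℝ}
    (he : 0 < e) (h : ∀ x, quadForm X (L *ᵥ x) + e * (x ⬝ᵥ x) ≤ quadForm X x) :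
    specRad L < 1 := by
  refine specRad_lt_one_iff.2 fun z v hv hz => ?_
  have h1 : hermForm X (z • v) + e * hermForm 1 v ≤ hermForm X v := by
    rw [← hz, hermForm, hermForm, hermForm, vecRe_toComplex_mulVec, vecIm_toComplex_mulVec,
      quadForm_one, quadForm_one]
    linarith [h (vecRe v), h (vecIm v)]
  rw [hermForm_smul hX.isSymm] at h1
  have h2 := mul_pos he (hermForm_one_pos hv)
  have h3 : 0 ≤ hermForm X v := add_nonneg (hX.quadForm_nonneg _) (hX.quadForm_nonneg _)
  by_contra! hz1
  have h4 : 1 ≤ ‖z‖ ^ 2 := one_le_pow₀ hz1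
  nlinarith

/-- A symmetric matrix whose quadratic form does not increase along the orbits of a stable
matrix is positive semidefinite. -/
theorem posSemidef_of_quadForm_mulVec_le {L X : Matrix (Fin p) (Fin p) ℝ} (hL : specRad L < 1)
    (hX : X.IsSymm) (h : ∀ x, quadForm X (L *ᵥ x) ≤ quadForm X x) : X.PosSemidef := by
  refine posSemidef_iff_quadForm.2 ⟨hX, fun x => ?_⟩
  have h1 : ∀ k : ℕ, quadForm X ((L ^ k) *ᵥ x) ≤ quadForm X x := by
    intro k
    induction k with
    | zero => simp
    | succ k ih =>
      rw [pow_succ', ← mulVec_mulVec]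
      exact (h _).trans ih
  have h2 : Filter.Tendsto (fun k => quadForm X ((L ^ k) *ᵥ x)) Filter.atTop
      (nhds (quadForm X ((0 : Matrix (Fin p) (Fin p) ℝ) *ᵥ x))) := by
    have hc : Continuous fun N : Matrix (Fin p) (Fin p) ℝ => quadForm X (N *ᵥ x) :=
      (continuous_quadForm X).comp (by fun_prop)
    exact (hc.tendsto 0).comp (tendsto_pow_of_specRad_lt_one hL)
  have h3 := le_of_tendsto' h2 h1
  simpa [quadForm] using h3

theorem specRad_transpose_lt_one_iff {M : Matrix (Fin p) (Fin p) ℝ} :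
    specRad Mᵀ < 1 ↔ specRad M < 1 := by
  have : spectrum ℂ (toComplex Mᵀ) = spectrum ℂ (toComplex M) := by
    ext z
    rw [Matrix.mem_spectrum_iff_isRoot_charpoly, Matrix.mem_spectrum_iff_isRoot_charpoly]
    have : toComplex Mᵀ = (toComplex M)ᵀ := rfl
    rw [this, Matrix.charpoly_transpose]
  rw [specRad, specRad, spectralRadius, spectralRadius, this]

/-- The Stein equation `X = Nᵀ X M` has only the trivial solution when `M` is stable and the
eigenvalues of `N` lie in the closed unit disc. -/
theorem eq_zero_of_eq_transpose_mul_mul {M N X : Matrix (Fin p) (Fin p) ℝ} (hM : specRad M < 1)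
    (hN : ∀ (z : ℂ) (v : Fin p → ℂ), v ≠ 0 → toComplex N *ᵥ v = z • v → ‖z‖ ≤ 1)
    (h : X = Nᵀ * X * M) : X = 0 := by
  obtain ⟨r, hr1, hr2⟩ := ENNReal.lt_iff_exists_nnreal_btwn.1 hM
  have hr3 : (r : ℝ) < 1 := by exact_mod_cast hr2
  have hr0 : 0 < r := by
    have := (zero_le (a := specRad M)).trans_lt hr1
    exact_mod_cast this
  have hr0' : (0 : ℝ) < r := hr0
  have hrC : ((r : ℝ) : ℂ) ≠ 0 := by exact_mod_cast hr0'.ne'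
  -- moving a factor `r < 1` from `M` to `N` makes both of them stable
  have hM' : specRad ((r : ℝ)⁻¹ • M) < 1 := by
    refine specRad_lt_one_iff.2 fun z v hv hz => ?_
    rw [toComplex_smul, smul_mulVec] at hz
    have h1 : toComplex M *ᵥ v = (((r : ℝ) : ℂ) * z) • v := by
      rw [mul_smul, ← hz, smul_smul]
      simp [hrC]
    have h2 := (specRad_lt_iff hr0).1 hr1 _ v hv h1
    rw [norm_mul, Complex.norm_real, Real.norm_of_nonneg hr0'.le] at h2
    by_contra! h3
    nlinarith
  have hN' : specRad ((r : ℝ) • N)ᵀ < 1 := by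
    refine specRad_transpose_lt_one_iff.2 (specRad_lt_one_iff.2 fun z v hv hz => ?_)
    rw [toComplex_smul, smul_mulVec] at hz
    have h1 : toComplex N *ᵥ v = ((((r : ℝ) : ℂ))⁻¹ * z) • v := by
      rw [mul_smul, ← hz, smul_smul]
      simp [hrC]
    have h2 := hN _ v hv h1
    rw [norm_mul, norm_inv, Complex.norm_real, Real.norm_of_nonneg hr0'.le,
      inv_mul_le_iff₀ hr0'] at h2
    linarith
  have h' : X = ((r : ℝ) • N)ᵀ * X * ((r : ℝ)⁻¹ • M) := by
    rw [transpose_smul, smul_mul, smul_mul, Matrix.mul_smul, smul_smul, mul_inv_cancel₀ hr0'.ne',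
      one_smul]
    exact h
  have hpow : ∀ k : ℕ, X = (((r : ℝ) • N)ᵀ) ^ k * X * ((r : ℝ)⁻¹ • M) ^ k := by
    intro k
    induction k with
    | zero => simp
    | succ k ih =>
      rw [pow_succ, pow_succ']
      calc X = (((r : ℝ) • N)ᵀ) ^ k * X * ((r : ℝ)⁻¹ • M) ^ k := ih
        _ = (((r : ℝ) • N)ᵀ) ^ k * (((r : ℝ) • N)ᵀ * X * ((r : ℝ)⁻¹ • M)) *
            ((r : ℝ)⁻¹ • M) ^ k := by rw [← h']
        _ = _ := by simp only [Matrix.mul_assoc]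
  have hlim := ((tendsto_pow_of_specRad_lt_one hN').mul_const X).mul
    (tendsto_pow_of_specRad_lt_one hM')
  have hconst : Filter.Tendsto (fun _ : ℕ => X) Filter.atTop (nhds X) := tendsto_const_nhds
  have := tendsto_nhds_unique (hconst.congr hpow) hlim
  simpa using this

end Spectral

/-! ### The operator `P ↦ P̃` as a worst-case value -/

namespace MixedDesign

variable {m d n l : ℕ} (S : MixedDesign m d n l)

/-- The matrix `γ² I - Dᵀ P D`. -/
def slack (P : Matrix (Fin m) (Fin m) ℝ) : Matrix (Fin n) (Fin n) ℝ :=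
  S.γ ^ 2 • (1 : Matrix (Fin n) (Fin n) ℝ) - S.Dᵀ * P * S.D

/-- The worst-case disturbance gain: `y ↦ (γ² I - Dᵀ P D)⁻¹ Dᵀ P y` maximizes
`w ↦ (y + D w)ᵀ P (y + D w) - γ² |w|²`. -/
noncomputable def worst (P : Matrix (Fin m) (Fin m) ℝ) : Matrix (Fin n) (Fin m) ℝ :=
  (S.slack P)⁻¹ * S.Dᵀ * P

/-- The matrix `I + D (γ² I - Dᵀ P D)⁻¹ Dᵀ P = (I - γ⁻² P D Dᵀ)⁻ᵀ`, which adds the worst-case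
disturbance to a state. -/
noncomputable def amplify (P : Matrix (Fin m) (Fin m) ℝ) : Matrix (Fin m) (Fin m) ℝ :=
  1 + S.D * S.worst P

variable {S} {P X : Matrix (Fin m) (Fin m) ℝ}

theorem slack_isSymm (hP : P.IsSymm) : (S.slack P).IsSymm := by
  simp [slack, IsSymm, hP.eq, Matrix.mul_assoc]

theorem quadForm_slack (P : Matrix (Fin m) (Fin m) ℝ) (w : Fin n → ℝ) :
    quadForm (S.slack P) w = S.γ ^ 2 * (w ⬝ᵥ w) - quadForm P (S.D *ᵥ w) := by
  rw [slack, quadForm_matrix_sub, quadForm_matrix_smul, quadForm_one, quadForm_congr]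

theorem posDef_slack_iff (hγ : 0 < S.γ) :
    (S.slack P).PosDef ↔
      ((1 : Matrix (Fin n) (Fin n) ℝ) - (S.γ ^ 2)⁻¹ • (S.Dᵀ * P * S.D)).PosDef := by
  have hγ2 : 0 < S.γ ^ 2 := by positivity
  have h1 : S.slack P = S.γ ^ 2 • ((1 : Matrix (Fin n) (Fin n) ℝ) -
      (S.γ ^ 2)⁻¹ • (S.Dᵀ * P * S.D)) := by
    rw [smul_sub, smul_smul, mul_inv_cancel₀ hγ2.ne', one_smul, slack]
  have h2 : ((1 : Matrix (Fin n) (Fin n) ℝ) - (S.γ ^ 2)⁻¹ • (S.Dᵀ * P * S.D)) =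
      (S.γ ^ 2)⁻¹ • S.slack P := by
    rw [h1, smul_smul, inv_mul_cancel₀ hγ2.ne', one_smul]
  constructor
  · intro h; rw [h2]; exact h.smul (inv_pos.2 hγ2)
  · intro h; rw [h1]; exact h.smul hγ2

theorem posDef_slack_of_le (hX : (S.slack X).PosDef) (hP : P.IsSymm)
    (h : ∀ x, quadForm P x ≤ quadForm X x) : (S.slack P).PosDef := by
  refine posDef_iff_quadForm.2 ⟨slack_isSymm hP, fun w hw => ?_⟩
  have h1 := (posDef_iff_quadForm.1 hX).2 w hw
  rw [quadForm_slack] at h1 ⊢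
  linarith [h (S.D *ᵥ w)]

theorem mul_inv_slack (hP : (S.slack P).PosDef) : S.slack P * (S.slack P)⁻¹ = 1 :=
  mul_nonsing_inv _ ((isUnit_iff_isUnit_det _).1 hP.isUnit)

theorem slack_mul_worst (hP : (S.slack P).PosDef) : S.slack P * S.worst P = S.Dᵀ * P := by
  rw [worst, ← Matrix.mul_assoc, ← Matrix.mul_assoc, mul_inv_slack hP, Matrix.one_mul]

theorem tilde_eq_add (P : Matrix (Fin m) (Fin m) ℝ) :
    S.tilde P = P + P * S.D * S.worst P := by
  simp only [tilde, worst, slack, Matrix.mul_assoc]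

theorem tilde_eq_mul_amplify (P : Matrix (Fin m) (Fin m) ℝ) : S.tilde P = P * S.amplify P := by
  rw [tilde_eq_add, amplify, Matrix.mul_add, Matrix.mul_one, Matrix.mul_assoc]

theorem tilde_isSymm (hP : P.IsSymm) : (S.tilde P).IsSymm := by
  have h1 : ((S.slack P)⁻¹)ᵀ = (S.slack P)⁻¹ := by
    rw [transpose_nonsing_inv, (slack_isSymm hP).eq]
  rw [tilde_eq_add, worst, IsSymm]
  simp only [transpose_add, transpose_mul, transpose_transpose, hP.eq, h1, Matrix.mul_assoc]

/-- The gain equation satisfied by the worst-case disturbance. -/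
theorem worst_eq (hγ : 0 < S.γ) (hP : (S.slack P).PosDef) :
    S.worst P = (S.γ ^ 2)⁻¹ • (S.Dᵀ * S.tilde P) := by
  have hγ2 : S.γ ^ 2 ≠ 0 := by positivity
  have h := slack_mul_worst hP
  rw [slack, Matrix.sub_mul, smul_mul, Matrix.one_mul, sub_eq_iff_eq_add] at h
  rw [tilde_eq_add, Matrix.mul_add, ← Matrix.mul_assoc, ← Matrix.mul_assoc, ← h, smul_smul,
    inv_mul_cancel₀ hγ2, one_smul]

theorem inv_transpose_eq_amplify (hγ : 0 < S.γ) (hP : P.IsSymm) (hΛ : (S.slack P).PosDef) :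
    (((1 : Matrix (Fin m) (Fin m) ℝ) - (S.γ ^ 2)⁻¹ • (P * S.D * S.Dᵀ))⁻¹)ᵀ = S.amplify P := by
  rw [transpose_nonsing_inv]
  refine inv_eq_right_inv ?_
  rw [transpose_sub, transpose_one, transpose_smul, transpose_mul, transpose_mul, hP.eq,
    transpose_transpose, Matrix.sub_mul, Matrix.one_mul, smul_mul, ← Matrix.mul_assoc,
    Matrix.mul_assoc (S.D * S.Dᵀ), ← tilde_eq_mul_amplify, amplify, worst_eq hγ hΛ,
    Matrix.mul_smul, Matrix.mul_assoc, add_sub_cancel_right]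

/-- Completion of the square in the disturbance. -/
theorem quadForm_add_mulVec_D (hP : P.IsSymm) (hΛ : (S.slack P).PosDef) (y : Fin m → ℝ)
    (w : Fin n → ℝ) : quadForm P (y + S.D *ᵥ w) - S.γ ^ 2 * (w ⬝ᵥ w) =
      quadForm (S.tilde P) y - quadForm (S.slack P) (w - S.worst P *ᵥ y) := by
  have h1 : S.slack P *ᵥ (S.worst P *ᵥ y) = (S.Dᵀ * P) *ᵥ y := by
    rw [mulVec_mulVec, slack_mul_worst hΛ]
  have h2 : y ⬝ᵥ (P * S.D * S.worst P) *ᵥ y = (S.worst P *ᵥ y) ⬝ᵥ (S.Dᵀ * P) *ᵥ y := by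
    rw [← mulVec_mulVec, dotProduct_mulVec_transpose, transpose_mul, hP.eq, dotProduct_comm]
  have h3 : y ⬝ᵥ P *ᵥ (S.D *ᵥ w) = w ⬝ᵥ (S.Dᵀ * P) *ᵥ y := by
    rw [mulVec_mulVec, dotProduct_mulVec_transpose, transpose_mul, hP.eq, dotProduct_comm]
  rw [quadForm_add hP, quadForm_sub (slack_isSymm hP), h1, h3, quadForm_slack P w, tilde_eq_add,
    quadForm_matrix_add]
  have h4 : quadForm (S.slack P) (S.worst P *ᵥ y) = y ⬝ᵥ (P * S.D * S.worst P) *ᵥ y := by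
    rw [quadForm, h1, h2]
  rw [h4, quadForm, quadForm, quadForm]
  ring

theorem quadForm_add_mulVec_D_le (hP : P.IsSymm) (hΛ : (S.slack P).PosDef) (y : Fin m → ℝ)
    (w : Fin n → ℝ) :
    quadForm P (y + S.D *ᵥ w) - S.γ ^ 2 * (w ⬝ᵥ w) ≤ quadForm (S.tilde P) y := by
  rw [quadForm_add_mulVec_D hP hΛ]
  linarith [hΛ.posSemidef.quadForm_nonneg (w - S.worst P *ᵥ y)]

theorem amplify_mulVec (y : Fin m → ℝ) :
    S.amplify P *ᵥ y = y + S.D *ᵥ (S.worst P *ᵥ y) := by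
  rw [amplify, add_mulVec, one_mulVec, mulVec_mulVec]

theorem quadForm_tilde (hP : P.IsSymm) (hΛ : (S.slack P).PosDef) (y : Fin m → ℝ) :
    quadForm (S.tilde P) y = quadForm P (S.amplify P *ᵥ y) -
      S.γ ^ 2 * ((S.worst P *ᵥ y) ⬝ᵥ (S.worst P *ᵥ y)) := by
  rw [amplify_mulVec, quadForm_add_mulVec_D hP hΛ, sub_self]
  simp [quadForm]

theorem quadForm_le_quadForm_tilde (hP : P.IsSymm) (hΛ : (S.slack P).PosDef) (y : Fin m → ℝ) :
    quadForm P y ≤ quadForm (S.tilde P) y := by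
  simpa using quadForm_add_mulVec_D_le hP hΛ y 0

theorem tilde_posSemidef (hP : P.PosSemidef) (hΛ : (S.slack P).PosDef) :
    (S.tilde P).PosSemidef :=
  posSemidef_iff_quadForm.2 ⟨tilde_isSymm hP.isSymm, fun y =>
    (hP.quadForm_nonneg y).trans (quadForm_le_quadForm_tilde hP.isSymm hΛ y)⟩

/-- Being a supremum of affine functions, `P ↦ P̃` is convex: it lies above its tangents. -/
theorem quadForm_tilde_tangent (hP : P.IsSymm) (hΛ : (S.slack P).PosDef) (hX : X.IsSymm)
    (hΛX : (S.slack X).PosDef) (y : Fin m → ℝ) :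
    quadForm (X - P) (S.amplify P *ᵥ y) ≤ quadForm (S.tilde X) y - quadForm (S.tilde P) y := by
  rw [quadForm_tilde hP hΛ, quadForm_matrix_sub]
  have := quadForm_add_mulVec_D_le hX hΛX y (S.worst P *ᵥ y)
  rw [← amplify_mulVec] at this
  linarith

theorem quadForm_tilde_mono (hP : P.IsSymm) (hX : X.IsSymm) (hΛX : (S.slack X).PosDef)
    (h : ∀ x, quadForm P x ≤ quadForm X x) (y : Fin m → ℝ) :
    quadForm (S.tilde P) y ≤ quadForm (S.tilde X) y := by
  have h1 := quadForm_tilde_tangent hP (posDef_slack_of_le hΛX hP h) hX hΛX y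
  rw [quadForm_matrix_sub] at h1
  linarith [h (S.amplify P *ᵥ y)]

/-! ### The closed-loop Riccati operator -/

variable (S) in
/-- The Riccati operator `P ↦ (A - B K)ᵀ P̃ (A - B K) + Cᵀ C + Kᵀ R K` of a gain `K`. -/
noncomputable def ricOp (K : Matrix (Fin d) (Fin m) ℝ) (P : Matrix (Fin m) (Fin m) ℝ) :
    Matrix (Fin m) (Fin m) ℝ :=
  (S.closedLoop K)ᵀ * S.tilde P * S.closedLoop K + S.weight K

variable {K : Matrix (Fin d) (Fin m) ℝ}

theorem riccati_iff : S.Riccati K P ↔ S.ricOp K P = P := by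
  rw [Riccati, ricOp, weight, sub_eq_zero, add_assoc]

theorem weight_isSymm (hR : S.R.PosDef) (K : Matrix (Fin d) (Fin m) ℝ) :
    (S.weight K).IsSymm := by
  simp [weight, IsSymm, hR.isSymm.eq, Matrix.mul_assoc]

theorem quadForm_weight (K : Matrix (Fin d) (Fin m) ℝ) (x : Fin m → ℝ) :
    quadForm (S.weight K) x = (S.C *ᵥ x) ⬝ᵥ (S.C *ᵥ x) + quadForm S.R (K *ᵥ x) := by
  rw [weight, quadForm_matrix_add, quadForm_congr]
  have := quadForm_congr 1 S.C x
  rw [Matrix.mul_one, quadForm_one] at this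
  rw [this]

theorem weight_posSemidef (hR : S.R.PosDef) (K : Matrix (Fin d) (Fin m) ℝ) :
    (S.weight K).PosSemidef :=
  posSemidef_iff_quadForm.2 ⟨weight_isSymm hR K, fun x => by
    rw [quadForm_weight]
    exact add_nonneg (dotProduct_self_nonneg _) (hR.posSemidef.quadForm_nonneg _)⟩

theorem ricOp_isSymm (hR : S.R.PosDef) (hP : P.IsSymm) : (S.ricOp K P).IsSymm := by
  have h1 := (weight_isSymm hR K).eq
  have h2 := (tilde_isSymm (S := S) hP).eq
  simp only [ricOp, IsSymm, transpose_add, transpose_mul, transpose_transpose, h1, h2,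
    Matrix.mul_assoc]

theorem quadForm_ricOp (K : Matrix (Fin d) (Fin m) ℝ) (P : Matrix (Fin m) (Fin m) ℝ)
    (x : Fin m → ℝ) : quadForm (S.ricOp K P) x =
      quadForm (S.tilde P) (S.closedLoop K *ᵥ x) + quadForm (S.weight K) x := by
  rw [ricOp, quadForm_matrix_add, quadForm_congr]

variable (S) in
/-- The state matrix `(I - γ⁻² P D Dᵀ)⁻ᵀ (A - B K)` of the closed loop under the worst-case
disturbance. -/
noncomputable def worstLoop (K : Matrix (Fin d) (Fin m) ℝ) (P : Matrix (Fin m) (Fin m) ℝ) :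
    Matrix (Fin m) (Fin m) ℝ :=
  S.amplify P * S.closedLoop K

/-- The tangent inequality of the Riccati operator. -/
theorem quadForm_ricOp_tangent (hP : P.IsSymm) (hΛ : (S.slack P).PosDef) (hX : X.IsSymm)
    (hΛX : (S.slack X).PosDef) (x : Fin m → ℝ) :
    quadForm (X - P) (S.worstLoop K P *ᵥ x) ≤
      quadForm (S.ricOp K X) x - quadForm (S.ricOp K P) x := by
  rw [worstLoop, ← mulVec_mulVec, quadForm_ricOp, quadForm_ricOp]
  linarith [quadForm_tilde_tangent hP hΛ hX hΛX (S.closedLoop K *ᵥ x)]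

theorem isStabilizingSolution_iff (hγ : 0 < S.γ) : S.IsStabilizingSolution K P ↔
    P.PosSemidef ∧ S.ricOp K P = P ∧ (S.slack P).PosDef ∧ specRad (S.worstLoop K P) < 1 := by
  constructor
  · rintro ⟨h1, h2, h3, h4⟩
    have h3' := (posDef_slack_iff hγ).2 h3
    rw [inv_transpose_eq_amplify hγ h1.isSymm h3'] at h4
    exact ⟨h1, riccati_iff.1 h2, h3', h4⟩
  · rintro ⟨h1, h2, h3, h4⟩
    refine ⟨h1, riccati_iff.2 h2, (posDef_slack_iff hγ).1 h3, ?_⟩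
    rw [inv_transpose_eq_amplify hγ h1.isSymm h3]
    exact h4

/-- Comparison principle: a stabilizing solution lies below every supersolution. -/
theorem IsStabilizingSolution.quadForm_le (hγ : 0 < S.γ) (h : S.IsStabilizingSolution K P)
    (hX : X.IsSymm) (hΛX : (S.slack X).PosDef)
    (hsup : ∀ x, quadForm (S.ricOp K X) x ≤ quadForm X x) (x : Fin m → ℝ) :
    quadForm P x ≤ quadForm X x := by
  obtain ⟨hP, hric, hΛ, hst⟩ := (isStabilizingSolution_iff hγ).1 h
  have hsymm : (X - P).IsSymm := hX.sub hP.isSymm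
  have := (posSemidef_of_quadForm_mulVec_le hst hsymm fun y => ?_).quadForm_nonneg x
  · rw [quadForm_matrix_sub] at this
    linarith
  · have h1 := quadForm_ricOp_tangent (K := K) hP.isSymm hΛ hX hΛX y
    rw [hric] at h1
    rw [quadForm_matrix_sub X P y]
    linarith [hsup y]

theorem IsStabilizingSolution.unique (hγ : 0 < S.γ) (hP : S.IsStabilizingSolution K P)
    (hX : S.IsStabilizingSolution K X) : P = X := by
  obtain ⟨hP1, hP2, hP3, -⟩ := (isStabilizingSolution_iff hγ).1 hP
  obtain ⟨hX1, hX2, hX3, -⟩ := (isStabilizingSolution_iff hγ).1 hX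
  exact hP1.isSymm.ext_quadForm hX1.isSymm fun x => le_antisymm
    (hP.quadForm_le hγ hX1.isSymm hX3 (fun y => by rw [hX2]) x)
    (hX.quadForm_le hγ hP1.isSymm hP3 (fun y => by rw [hP2]) x)

/-! ### Continuity of the Riccati operator -/

theorem tendsto_matrix_mul {a b c : Type*} [Fintype b] {M : ℕ → Matrix a b ℝ}
    {N : ℕ → Matrix b c ℝ} {M' : Matrix a b ℝ} {N' : Matrix b c ℝ}
    (hM : Filter.Tendsto M Filter.atTop (nhds M')) (hN : Filter.Tendsto N Filter.atTop (nhds N')) :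
    Filter.Tendsto (fun k => M k * N k) Filter.atTop (nhds (M' * N')) := by
  have h : Continuous fun p : Matrix a b ℝ × Matrix b c ℝ => p.1 * p.2 := by fun_prop
  exact (h.tendsto (M', N')).comp (hM.prodMk_nhds hN)

theorem tendsto_inv_of_isUnit {q : ℕ} {M : ℕ → Matrix (Fin q) (Fin q) ℝ}
    {L : Matrix (Fin q) (Fin q) ℝ} (h : Filter.Tendsto M Filter.atTop (nhds L)) (hL : IsUnit L) :
    Filter.Tendsto (fun k => (M k)⁻¹) Filter.atTop (nhds L⁻¹) := by
  have hdet : L.det ≠ 0 := ((isUnit_iff_isUnit_det _).1 hL).ne_zero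
  simp only [inv_def, Ring.inverse_eq_inv']
  have h1 : Filter.Tendsto (fun k => (M k).det) Filter.atTop (nhds L.det) :=
    ((continuous_id.matrix_det).tendsto L).comp h
  have h2 : Filter.Tendsto (fun k => (M k).adjugate) Filter.atTop (nhds L.adjugate) :=
    ((continuous_id.matrix_adjugate).tendsto L).comp h
  exact (h1.inv₀ hdet).smul h2

variable {Q : ℕ → Matrix (Fin m) (Fin m) ℝ}

theorem tendsto_worst (hQ : Filter.Tendsto Q Filter.atTop (nhds P)) (hΛ : (S.slack P).PosDef) :
    Filter.Tendsto (fun k => S.worst (Q k)) Filter.atTop (nhds (S.worst P)) := by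
  have h1 : Filter.Tendsto (fun k => S.slack (Q k)) Filter.atTop (nhds (S.slack P)) := by
    have : Continuous S.slack := by unfold slack; fun_prop
    exact (this.tendsto P).comp hQ
  simp only [worst]
  exact tendsto_matrix_mul (tendsto_matrix_mul (tendsto_inv_of_isUnit h1 hΛ.isUnit)
    tendsto_const_nhds) hQ

theorem tendsto_amplify (hQ : Filter.Tendsto Q Filter.atTop (nhds P))
    (hΛ : (S.slack P).PosDef) :
    Filter.Tendsto (fun k => S.amplify (Q k)) Filter.atTop (nhds (S.amplify P)) := by
  have h : Continuous fun W : Matrix (Fin n) (Fin m) ℝ => 1 + S.D * W := by fun_prop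
  exact (h.tendsto _).comp (tendsto_worst hQ hΛ)

theorem tendsto_tilde (hQ : Filter.Tendsto Q Filter.atTop (nhds P)) (hΛ : (S.slack P).PosDef) :
    Filter.Tendsto (fun k => S.tilde (Q k)) Filter.atTop (nhds (S.tilde P)) := by
  simp only [tilde_eq_mul_amplify]
  exact hQ.mul (tendsto_amplify hQ hΛ)

theorem tendsto_ricOp {G : ℕ → Matrix (Fin d) (Fin m) ℝ}
    (hG : Filter.Tendsto G Filter.atTop (nhds K))
    (hQ : Filter.Tendsto Q Filter.atTop (nhds P)) (hΛ : (S.slack P).PosDef) :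
    Filter.Tendsto (fun k => S.ricOp (G k) (Q k)) Filter.atTop (nhds (S.ricOp K P)) := by
  have h1 : Filter.Tendsto (fun k => S.closedLoop (G k)) Filter.atTop
      (nhds (S.closedLoop K)) := by
    have : Continuous S.closedLoop := by unfold closedLoop; fun_prop
    exact (this.tendsto K).comp hG
  have h2 : Filter.Tendsto (fun k => S.weight (G k)) Filter.atTop (nhds (S.weight K)) := by
    have : Continuous S.weight := by unfold weight; fun_prop
    exact (this.tendsto K).comp hG
  have h3 : Filter.Tendsto (fun k => (S.closedLoop (G k))ᵀ) Filter.atTop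
      (nhds (S.closedLoop K)ᵀ) :=
    ((continuous_id.matrix_transpose).tendsto _).comp h1
  exact ((h3.mul (tendsto_tilde hQ hΛ)).mul h1).add h2

end MixedDesign

/-! ### Operator norms and the transfer function -/

section OpNorm

open scoped Matrix.Norms.L2Operator

variable {𝕜 : Type*} [RCLike 𝕜] {p q : ℕ}

theorem opNorm_nonneg (M : Matrix (Fin p) (Fin q) 𝕜) : 0 ≤ opNorm M := norm_nonneg _

theorem opNorm_le_of_sum_le {M : Matrix (Fin p) (Fin q) 𝕜} {c : ℝ} (hc : 0 ≤ c)
    (h : ∀ v : Fin q → 𝕜, ∑ i, ‖(M *ᵥ v) i‖ ^ 2 ≤ c ^ 2 * ∑ i, ‖v i‖ ^ 2) : opNorm M ≤ c := by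
  rw [opNorm, l2_opNorm_def]
  refine ContinuousLinearMap.opNorm_le_bound _ hc fun v => ?_
  refine (sq_le_sq₀ (norm_nonneg _) (by positivity)).1 ?_
  rw [mul_pow, EuclideanSpace.norm_sq_eq, EuclideanSpace.norm_sq_eq]
  exact h v.ofLp

theorem sum_norm_mulVec_sq_le (M : Matrix (Fin p) (Fin q) 𝕜) (v : Fin q → 𝕜) :
    ∑ i, ‖(M *ᵥ v) i‖ ^ 2 ≤ opNorm M ^ 2 * ∑ i, ‖v i‖ ^ 2 := by
  have h := l2_opNorm_mulVec M (WithLp.toLp 2 v)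
  have h2 := pow_le_pow_left₀ (norm_nonneg _) h 2
  rw [mul_pow, EuclideanSpace.norm_sq_eq, EuclideanSpace.norm_sq_eq] at h2
  exact h2

theorem quadForm_le_opNorm (M : Matrix (Fin p) (Fin p) ℝ) (v : Fin p → ℝ) :
    quadForm M v ≤ opNorm M * (v ⬝ᵥ v) := by
  have h := real_inner_le_norm (WithLp.toLp 2 v) (WithLp.toLp 2 (M *ᵥ v))
  have h1 : inner ℝ (WithLp.toLp 2 v) (WithLp.toLp 2 (M *ᵥ v)) = quadForm M v := by
    rw [EuclideanSpace.inner_toLp_toLp, quadForm, dotProduct_comm]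
    simp
  have h2 : v ⬝ᵥ v = ‖WithLp.toLp 2 v‖ ^ 2 := by
    rw [EuclideanSpace.norm_sq_eq]
    simp [dotProduct, pow_two]
  rw [h1] at h
  have h3 := l2_opNorm_mulVec M (WithLp.toLp 2 v)
  rw [h2, opNorm]
  calc _ ≤ _ := h
    _ ≤ ‖WithLp.toLp 2 v‖ * (‖M‖ * ‖WithLp.toLp 2 v‖) :=
      mul_le_mul_of_nonneg_left h3 (norm_nonneg _)
    _ = _ := by ring

end OpNorm

theorem hermForm_one_toComplex_mulVec {p q : ℕ} (M : Matrix (Fin p) (Fin q) ℝ) (v : Fin q → ℂ) :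
    hermForm 1 (toComplex M *ᵥ v) = hermForm (Mᵀ * M) v := by
  have h := fun x => quadForm_congr 1 M x
  simp only [Matrix.mul_one] at h
  rw [hermForm, hermForm, vecRe_toComplex_mulVec, vecIm_toComplex_mulVec, h, h]

theorem isUnit_smul_one_sub_toComplex {p : ℕ} {M : Matrix (Fin p) (Fin p) ℝ} (hM : specRad M < 1)
    {z : ℂ} (hz : 1 ≤ ‖z‖) : IsUnit (z • (1 : Matrix (Fin p) (Fin p) ℂ) - toComplex M) := by
  rw [← Algebra.algebraMap_eq_smul_one, ← spectrum.notMem_iff]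
  intro h
  obtain ⟨v, hv, hzv⟩ := mem_spectrum_iff_mulVec.1 h
  exact (specRad_lt_one_iff.1 hM z v hv hzv).not_ge hz

namespace MixedDesign

variable {m d n l : ℕ} {S : MixedDesign m d n l} {K : Matrix (Fin d) (Fin m) ℝ}
  {P X : Matrix (Fin m) (Fin m) ℝ}

section

open scoped MatrixOrder

theorem weightSqrt_transpose_mul_self (hR : S.R.PosDef) (K : Matrix (Fin d) (Fin m) ℝ) :
    (S.weightSqrt K)ᵀ * S.weightSqrt K = S.weight K := by
  have h0 : 0 ≤ S.weight K := nonneg_iff_posSemidef.2 (weight_posSemidef hR K)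
  have h1 : (S.weightSqrt K).PosSemidef := nonneg_iff_posSemidef.1 (CFC.sqrt_nonneg _)
  rw [h1.isSymm.eq]
  exact CFC.sqrt_mul_sqrt_self _ h0

end

/-- The state driven by the disturbance `w` at the frequency `z`. -/
theorem exists_transfer_mulVec (hR : S.R.PosDef) (hK : specRad (S.closedLoop K) < 1) {z : ℂ}
    (hz : 1 ≤ ‖z‖) (w : Fin n → ℂ) : ∃ x : Fin m → ℂ,
      z • x = toComplex (S.closedLoop K) *ᵥ x + toComplex S.D *ᵥ w ∧
      hermForm 1 (S.transfer K z *ᵥ w) = hermForm (S.weight K) x := by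
  have hu := isUnit_smul_one_sub_toComplex hK hz
  refine ⟨(z • (1 : Matrix (Fin m) (Fin m) ℂ) - toComplex (S.closedLoop K))⁻¹ *ᵥ
    (toComplex S.D *ᵥ w), ?_, ?_⟩
  · rw [← sub_eq_iff_eq_add']
    have h1 : ∀ x : Fin m → ℂ, z • x - toComplex (S.closedLoop K) *ᵥ x =
        (z • (1 : Matrix (Fin m) (Fin m) ℂ) - toComplex (S.closedLoop K)) *ᵥ x := fun x => by
      rw [sub_mulVec, smul_mulVec, one_mulVec]
    rw [h1, mulVec_mulVec, mul_nonsing_inv _ ((isUnit_iff_isUnit_det _).1 hu), one_mulVec]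
  · rw [transfer, ← mulVec_mulVec, ← mulVec_mulVec, hermForm_one_toComplex_mulVec,
      weightSqrt_transpose_mul_self hR]

theorem transfer_mulVec (hR : S.R.PosDef) (hK : specRad (S.closedLoop K) < 1) {z : ℂ}
    (hz : 1 ≤ ‖z‖) {x : Fin m → ℂ} {w : Fin n → ℂ}
    (h : z • x = toComplex (S.closedLoop K) *ᵥ x + toComplex S.D *ᵥ w) :
    hermForm 1 (S.transfer K z *ᵥ w) = hermForm (S.weight K) x := by
  have hu := (isUnit_iff_isUnit_det _).1 (isUnit_smul_one_sub_toComplex hK hz)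
  have h1 : (z • (1 : Matrix (Fin m) (Fin m) ℂ) - toComplex (S.closedLoop K)) *ᵥ x =
      toComplex S.D *ᵥ w := by
    rw [sub_mulVec, smul_mulVec, one_mulVec, h, add_sub_cancel_left]
  rw [transfer, ← mulVec_mulVec, ← mulVec_mulVec, ← h1, mulVec_mulVec x, nonsing_inv_mul _ hu,
    one_mulVec, hermForm_one_toComplex_mulVec, weightSqrt_transpose_mul_self hR]

/-! ### The strict bounded real inequality -/

variable (S) in
/-- The strict bounded real inequality for the gain `K` and the storage matrix `X`: along
`x⁺ = (A - B K) x + D w`, the storage `xᵀ X x` dissipates `γ² |w|² - |z|²` with a margin. -/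
def StrictDissipation (K : Matrix (Fin d) (Fin m) ℝ) (X : Matrix (Fin m) (Fin m) ℝ) : Prop :=
  X.PosSemidef ∧ ∃ e : ℝ, 0 < e ∧ ∀ (x : Fin m → ℝ) (w : Fin n → ℝ),
    quadForm X (S.closedLoop K *ᵥ x + S.D *ᵥ w) + quadForm (S.weight K) x +
      e * (x ⬝ᵥ x + w ⬝ᵥ w) ≤ quadForm X x + S.γ ^ 2 * (w ⬝ᵥ w)

theorem StrictDissipation.posDef_slack (h : S.StrictDissipation K X) : (S.slack X).PosDef := by
  obtain ⟨hX, e, he, h⟩ := h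
  refine posDef_iff_quadForm.2 ⟨slack_isSymm hX.isSymm, fun w hw => ?_⟩
  have h1 := h 0 w
  have h2 : 0 < w ⬝ᵥ w := (dotProduct_self_nonneg w).lt_of_ne'
    fun h0 => hw (dotProduct_self_eq_zero.1 h0)
  have h3 := mul_pos he h2
  simp only [mulVec_zero, zero_add, quadForm, dotProduct_zero] at h1
  rw [quadForm_slack, quadForm]
  linarith

theorem StrictDissipation.exists_ricOp_le (h : S.StrictDissipation K X) : ∃ e : ℝ, 0 < e ∧
    ∀ x, quadForm (S.ricOp K X) x + e * (x ⬝ᵥ x) ≤ quadForm X x := by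
  have hΛ := h.posDef_slack
  obtain ⟨hX, e, he, h⟩ := h
  refine ⟨e, he, fun x => ?_⟩
  have h1 := h x (S.worst X *ᵥ (S.closedLoop K *ᵥ x))
  rw [← amplify_mulVec] at h1
  rw [quadForm_ricOp, quadForm_tilde hX.isSymm hΛ]
  have h2 := mul_nonneg he.le (dotProduct_self_nonneg (S.worst X *ᵥ (S.closedLoop K *ᵥ x)))
  linarith

theorem StrictDissipation.specRad_lt_one (hR : S.R.PosDef) (h : S.StrictDissipation K X) :
    specRad (S.closedLoop K) < 1 := by
  obtain ⟨hX, e, he, h⟩ := h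
  refine specRad_lt_one_of_lyapunov hX he fun x => ?_
  have h1 := h x 0
  simp only [mulVec_zero, add_zero, dotProduct_zero, mul_zero] at h1
  linarith [(weight_posSemidef hR K).quadForm_nonneg x]

/-- Sufficiency in the strict bounded real lemma. -/
theorem StrictDissipation.mem_feasible (hR : S.R.PosDef) (hγ : 0 < S.γ)
    (h : S.StrictDissipation K X) : K ∈ S.feasible := by
  have hst := h.specRad_lt_one hR
  obtain ⟨hX, e, he, h⟩ := h
  refine ⟨hst, ?_⟩
  set c := Real.sqrt (max (S.γ ^ 2 - e) 0) with hc
  have hc2 : c ^ 2 = max (S.γ ^ 2 - e) 0 := Real.sq_sqrt (le_max_right _ _)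
  have hcγ : c < S.γ := by
    rw [hc, Real.sqrt_lt' hγ]
    exact max_lt (by linarith) (by positivity)
  refine lt_of_le_of_lt (iSup₂_le fun θ _ => ENNReal.ofReal_le_ofReal ?_)
    ((ENNReal.ofReal_lt_ofReal_iff hγ).2 hcγ)
  refine opNorm_le_of_sum_le (Real.sqrt_nonneg _) fun w => ?_
  set z := Complex.exp (Complex.I * (θ : ℂ)) with hz
  have hz1 : ‖z‖ = 1 := by rw [hz, mul_comm, Complex.norm_exp_ofReal_mul_I]
  obtain ⟨x, hx, hxw⟩ := exists_transfer_mulVec hR hst hz1.ge w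
  rw [← hermForm_one_eq_sum, ← hermForm_one_eq_sum, hxw, hc2]
  have h1 : hermForm X (z • x) + hermForm (S.weight K) x + e * (hermForm 1 x + hermForm 1 w) ≤
      hermForm X x + S.γ ^ 2 * hermForm 1 w := by
    have hre : vecRe (z • x) = S.closedLoop K *ᵥ vecRe x + S.D *ᵥ vecRe w := by
      rw [hx, ← vecRe_toComplex_mulVec, ← vecRe_toComplex_mulVec]
      ext i; simp [vecRe]
    have him : vecIm (z • x) = S.closedLoop K *ᵥ vecIm x + S.D *ᵥ vecIm w := by
      rw [hx, ← vecIm_toComplex_mulVec, ← vecIm_toComplex_mulVec]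
      ext i; simp [vecIm]
    simp only [hermForm, hre, him, quadForm_one]
    linarith [h (vecRe x) (vecRe w), h (vecIm x) (vecIm w)]
  rw [hermForm_smul hX.isSymm, hz1] at h1
  have hw0 : 0 ≤ hermForm 1 w := by rw [hermForm_one_eq_sum]; positivity
  have hx0 : 0 ≤ hermForm 1 x := by rw [hermForm_one_eq_sum]; positivity
  have h2 := mul_le_mul_of_nonneg_right (le_max_left (S.γ ^ 2 - e) 0) hw0
  nlinarith

/-- A strictly dissipative gain has a stabilizing solution: value iteration from `0` increases
to it. -/
theorem StrictDissipation.exists_isStabilizingSolution (hR : S.R.PosDef) (hγ : 0 < S.γ)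
    (h : S.StrictDissipation K X) : ∃ P, S.IsStabilizingSolution K P := by
  have hΛX := h.posDef_slack
  obtain ⟨e, he, hric⟩ := h.exists_ricOp_le
  have hX := h.1
  have hXs := hX.isSymm
  have hric' : ∀ x, quadForm (S.ricOp K X) x ≤ quadForm X x := fun x => by
    have := mul_nonneg he.le (dotProduct_self_nonneg x)
    linarith [hric x]
  let Q : ℕ → Matrix (Fin m) (Fin m) ℝ := fun k => (S.ricOp K)^[k] 0
  have hQ : ∀ k, Q (k + 1) = S.ricOp K (Q k) := fun k => Function.iterate_succ_apply' _ _ _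
  have hQs : ∀ k, (Q k).IsSymm := by
    intro k
    induction k with
    | zero => exact transpose_zero
    | succ k ih => rw [hQ]; exact ricOp_isSymm hR ih
  have hQX : ∀ k x, quadForm (Q k) x ≤ quadForm X x := by
    intro k
    induction k with
    | zero => intro x; simpa [Q, quadForm] using hX.quadForm_nonneg x
    | succ k ih =>
      intro x
      refine le_trans ?_ (hric' x)
      rw [hQ, quadForm_ricOp, quadForm_ricOp]
      linarith [quadForm_tilde_mono (S := S) (hQs k) hXs hΛX ih (S.closedLoop K *ᵥ x)]
  have hΛQ : ∀ k, (S.slack (Q k)).PosDef := fun k => posDef_slack_of_le hΛX (hQs k) (hQX k)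
  have hmono : ∀ k x, quadForm (Q k) x ≤ quadForm (Q (k + 1)) x := by
    intro k
    induction k with
    | zero =>
      intro x
      have h1 := quadForm_le_quadForm_tilde (hQs 0) (hΛQ 0) (S.closedLoop K *ᵥ x)
      have h2 := (weight_posSemidef hR K).quadForm_nonneg x
      rw [hQ, quadForm_ricOp]
      simp only [Q, Function.iterate_zero, id_eq, quadForm, zero_mulVec, dotProduct_zero] at *
      linarith
    | succ k ih =>
      intro x
      rw [hQ (k + 1), quadForm_ricOp]
      nth_rw 1 [hQ k]
      rw [quadForm_ricOp]
      linarith [quadForm_tilde_mono (S := S) (hQs k) (hQs (k + 1)) (hΛQ (k + 1)) ih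
        (S.closedLoop K *ᵥ x)]
  obtain ⟨P, hPs, hlim, hQP, hPX⟩ :=
    exists_tendsto_of_monotone_quadForm hQs (fun x k => hmono k x) (fun x k => hQX k x)
  have hΛ : (S.slack P).PosDef := posDef_slack_of_le hΛX hPs hPX
  have hP : P.PosSemidef := posSemidef_iff_quadForm.2 ⟨hPs, fun x => by
    simpa [Q, quadForm] using hQP x 0⟩
  have hfix : S.ricOp K P = P := by
    have h1 := tendsto_ricOp (S := S) (K := K) tendsto_const_nhds hlim hΛ
    refine tendsto_nhds_unique h1 (((Filter.tendsto_add_atTop_iff_nat 1).2 hlim).congr fun k => ?_)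
    exact hQ k
  refine ⟨P, (isStabilizingSolution_iff hγ).2 ⟨hP, hfix, hΛ, ?_⟩⟩
  -- `X - P` is a strict Lyapunov function for the worst-case closed loop
  have hXP : (X - P).PosSemidef := posSemidef_iff_quadForm.2 ⟨hXs.sub hPs, fun x => by
    rw [quadForm_matrix_sub]; linarith [hPX x]⟩
  refine specRad_lt_one_of_lyapunov hXP he fun x => ?_
  have h1 := quadForm_ricOp_tangent (K := K) hPs hΛ hXs hΛX x
  rw [hfix] at h1
  rw [quadForm_matrix_sub X P x]
  linarith [hric x]

end MixedDesign

/-! ### Isometries of finite-dimensional spaces -/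

section Isometry

variable {E : Type*} [NormedAddCommGroup E] [InnerProductSpace ℂ E] [FiniteDimensional ℂ E]

/-- Two linear maps with the same norms differ by an isometry of the target. -/
theorem exists_linearIsometry_of_norm_eq {H : Type*} [AddCommGroup H] [Module ℂ H]
    (f g : H →ₗ[ℂ] E) (h : ∀ u, ‖f u‖ = ‖g u‖) : ∃ T : E →ₗᵢ[ℂ] E, ∀ u, T (f u) = g u := by
  obtain ⟨s, hs⟩ := f.rangeRestrict.exists_rightInverse_of_surjective f.range_rangeRestrict
  have hs' : ∀ y : LinearMap.range f, f (s y) = y := fun y =>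
    congrArg Subtype.val (LinearMap.congr_fun hs y)
  let L : LinearMap.range f →ₗᵢ[ℂ] E := ⟨g ∘ₗ s, fun y => by
    rw [LinearMap.comp_apply, ← h, hs', Submodule.coe_norm]⟩
  refine ⟨L.extend, fun u => ?_⟩
  have h1 := L.extend_apply ⟨f u, LinearMap.mem_range_self f u⟩
  refine h1.trans ?_
  change g (s ⟨f u, LinearMap.mem_range_self f u⟩) = g u
  rw [← sub_eq_zero, ← map_sub, ← norm_eq_zero, ← h, map_sub, hs', sub_self, norm_zero]

/-- A linear isometry of a finite-dimensional complex space has an orthonormal basis of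
eigenvectors: they are the eigenvectors of its Cayley transform, which is self-adjoint. -/
theorem LinearIsometry.exists_orthonormalBasis_eigenvectors {r : ℕ} (T : E →ₗᵢ[ℂ] E)
    (hr : Module.finrank ℂ E = r) :
    ∃ (b : OrthonormalBasis (Fin r) ℂ E) (z : Fin r → ℂ), ∀ k, T (b k) = z k • b k := by
  -- a point of the unit circle that is not an eigenvalue
  obtain ⟨c, hc1, hc2⟩ : ∃ c : ℂ, ‖c‖ = 1 ∧ ¬ Module.End.HasEigenvalue T.toLinearMap c := by
    have hfin : {c : ℂ | Module.End.HasEigenvalue T.toLinearMap c}.Finite :=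
      Module.End.finite_hasEigenvalue _
    have hinf : {c : ℂ | ‖c‖ = 1}.Infinite := by
      refine Set.infinite_of_injOn_mapsTo (f := fun t : ℝ => (⟨t, Real.sqrt (1 - t ^ 2)⟩ : ℂ))
        (fun s _ t _ h => congrArg Complex.re h) (fun t ht => ?_)
        (Set.Icc_infinite (zero_lt_one' ℝ))
      have h1 : 0 ≤ 1 - t ^ 2 := by nlinarith [ht.1, ht.2]
      have h2 := Real.mul_self_sqrt h1
      refine (pow_eq_one_iff_of_nonneg (norm_nonneg _) two_ne_zero).1 ?_
      rw [← Complex.normSq_eq_norm_sq, Complex.normSq_mk, h2]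
      ring
    obtain ⟨c, hc, hc'⟩ := (hinf.sdiff hfin).nonempty
    exact ⟨c, hc, hc'⟩
  let N : E →ₗ[ℂ] E := c • LinearMap.id - T.toLinearMap
  have hN : ∀ a, N a = c • a - T a := fun a => rfl
  have hinj : Function.Injective N := by
    refine (injective_iff_map_eq_zero N).2 fun a ha => ?_
    by_contra ha0
    rw [hN, sub_eq_zero] at ha
    exact hc2 (Module.End.hasEigenvalue_of_hasEigenvector
      (Module.End.hasEigenvector_iff.2 ⟨Module.End.mem_eigenspace_iff.2 ha.symm, ha0⟩))
  let e : E ≃ₗ[ℂ] E := LinearEquiv.ofInjectiveEndo N hinj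
  have he : ∀ a, e a = c • a - T a := fun a => rfl
  let H : E →ₗ[ℂ] E := (Complex.I • (c • LinearMap.id + T.toLinearMap)) ∘ₗ e.symm.toLinearMap
  have hH : ∀ a, H (e a) = Complex.I • (c • a + T a) := fun a => by
    change Complex.I • (c • e.symm (e a) + T (e.symm (e a))) = _
    rw [e.symm_apply_apply]
  have hsymm : H.IsSymmetric := by
    intro x y
    obtain ⟨a, rfl⟩ := e.surjective x
    obtain ⟨b, rfl⟩ := e.surjective y
    rw [hH, hH, he, he]
    have h1 : inner ℂ (T a) (T b) = inner ℂ a b := T.inner_map_map a b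
    have h2 : (starRingEnd ℂ) c * c = 1 := by
      rw [← Complex.normSq_eq_conj_mul_self, Complex.normSq_eq_norm_sq, hc1]; simp
    simp only [inner_smul_left, inner_smul_right, inner_add_left, inner_add_right,
      inner_sub_left, inner_sub_right, h1, Complex.conj_I]
    linear_combination (-2 * Complex.I * inner ℂ a b) * h2
  refine ⟨hsymm.eigenvectorBasis hr, ?_⟩
  have key : ∀ k, ∃ z : ℂ, T (hsymm.eigenvectorBasis hr k) = z • hsymm.eigenvectorBasis hr k := by
    intro k
    set b := hsymm.eigenvectorBasis hr k with hb
    set μ : ℝ := hsymm.eigenvalues hr k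
    have h1 : H b = (μ : ℂ) • b := hsymm.apply_eigenvectorBasis hr k
    obtain ⟨a, ha⟩ := e.surjective b
    rw [← ha, hH, he] at h1
    have hμ : (μ : ℂ) + Complex.I ≠ 0 := by
      intro h
      have := congrArg Complex.im h
      simp at this
    have h2 : ((μ : ℂ) + Complex.I) • T a = (((μ : ℂ) - Complex.I) * c) • a := by
      have h3 : ((μ : ℂ) + Complex.I) • T a - (((μ : ℂ) - Complex.I) * c) • a =
        Complex.I • (c • a + T a) - (μ : ℂ) • (c • a - T a) := by module
      rw [← sub_eq_zero, h3, h1, sub_self]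
    set z := ((μ : ℂ) + Complex.I)⁻¹ * (((μ : ℂ) - Complex.I) * c)
    have h4 : T a = z • a := by
      rw [mul_smul, ← h2, smul_smul, inv_mul_cancel₀ hμ, one_smul]
    refine ⟨z, ?_⟩
    rw [← ha, he, map_sub, map_smul, h4, map_smul, h4]
    module
  choose z hz using key
  exact ⟨z, hz⟩

end Isometry

/-! ### The Kalman-Yakubovich-Popov lemma -/

section KYP

theorem quadForm_eq_trace {a : Type*} [Fintype a] (M : Matrix a a ℝ) (x : a → ℝ) :
    quadForm M x = (M * vecMulVec x x).trace := by
  rw [mul_vecMulVec, trace_vecMulVec, dotProduct_comm, quadForm]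

theorem hermForm_map_mulVec {a b : Type*} [Fintype a] [Fintype b] (M : Matrix a a ℝ)
    (Y : Matrix a b ℝ) (v : b → ℂ) :
    hermForm M (Y.map (algebraMap ℝ ℂ) *ᵥ v) = hermForm (Yᵀ * M * Y) v := by
  rw [hermForm, hermForm, map_ofReal_mulVec_re, map_ofReal_mulVec_im, quadForm_congr,
    quadForm_congr]

/-- The trace is the sum of the values of the quadratic form over an orthonormal basis. -/
theorem sum_hermForm_orthonormalBasis {a κ : Type*} [Fintype a] [DecidableEq a] [Fintype κ]
    (b : OrthonormalBasis κ ℂ (EuclideanSpace ℂ a)) (M : Matrix a a ℝ) :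
    ∑ k, hermForm M (b k).ofLp = M.trace := by
  have key : ∀ i j : a, ∑ k, ((b k i).re * (b k j).re + (b k i).im * (b k j).im) =
      (1 : Matrix a a ℝ) i j := by
    intro i j
    have h := congrArg Complex.re
      (b.sum_inner_mul_inner (EuclideanSpace.single j 1) (EuclideanSpace.single i 1))
    have h1 : (inner ℂ (EuclideanSpace.single j (1 : ℂ)) (EuclideanSpace.single i (1 : ℂ))).re =
        (1 : Matrix a a ℝ) i j := by
      by_cases hij : i = j
      · subst hij; simp
      · simp [EuclideanSpace.inner_single_left, hij, Ne.symm hij]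
    rw [h1, Complex.re_sum] at h
    rw [← h]
    refine Finset.sum_congr rfl fun k _ => ?_
    simp [EuclideanSpace.inner_single_left, EuclideanSpace.inner_single_right]
    ring
  calc ∑ k, hermForm M (b k).ofLp
      = ∑ k, ∑ i, ∑ j, M i j * ((b k i).re * (b k j).re + (b k i).im * (b k j).im) := by
        refine Finset.sum_congr rfl fun k _ => ?_
        simp only [hermForm, quadForm, dotProduct, mulVec, vecRe, vecIm, Finset.mul_sum,
          ← Finset.sum_add_distrib]
        refine Finset.sum_congr rfl fun i _ => Finset.sum_congr rfl fun j _ => ?_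
        ring
    _ = ∑ i, ∑ j, M i j * (1 : Matrix a a ℝ) i j := by
        rw [Finset.sum_comm]
        refine Finset.sum_congr rfl fun i _ => ?_
        rw [Finset.sum_comm]
        refine Finset.sum_congr rfl fun j _ => ?_
        rw [← key, Finset.mul_sum]
    _ = M.trace := by simp [Matrix.one_apply, trace]

/-- If `V Vᵀ = X Xᵀ`, then the columns can be rotated by a unitary matrix so that corresponding
columns of `V` and `X` are proportional, with ratios on the unit circle. -/
theorem exists_orthonormalBasis_of_mul_transpose_eq {a b : Type*} [Fintype a] [Fintype b]
    [DecidableEq a] [DecidableEq b] {V X : Matrix a b ℝ} (h : V * Vᵀ = X * Xᵀ) :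
    ∃ (e : OrthonormalBasis (Fin (Fintype.card b)) ℂ (EuclideanSpace ℂ b))
      (z : Fin (Fintype.card b) → ℂ), ∀ k, ‖z k‖ = 1 ∧
        V.map (algebraMap ℝ ℂ) *ᵥ (e k).ofLp = z k • (X.map (algebraMap ℝ ℂ) *ᵥ (e k).ofLp) := by
  set Vc := V.map (algebraMap ℝ ℂ) with hVc
  set Xc := X.map (algebraMap ℝ ℂ) with hXc
  have hH : ∀ Y : Matrix a b ℝ, (Y.map (algebraMap ℝ ℂ))ᴴ = Yᵀ.map (algebraMap ℝ ℂ) := by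
    intro Y; ext i j; simp
  have hc : Vc * Vcᴴ = Xc * Xcᴴ := by
    rw [hVc, hXc, hH, hH, ← Matrix.map_mul, ← Matrix.map_mul, h]
  let f : (a → ℂ) →ₗ[ℂ] EuclideanSpace ℂ b :=
    (WithLp.linearEquiv 2 ℂ (b → ℂ)).symm.toLinearMap ∘ₗ Xcᴴ.mulVecLin
  let g : (a → ℂ) →ₗ[ℂ] EuclideanSpace ℂ b :=
    (WithLp.linearEquiv 2 ℂ (b → ℂ)).symm.toLinearMap ∘ₗ Vcᴴ.mulVecLin
  have hinner : ∀ (Y : Matrix a b ℂ) (y : EuclideanSpace ℂ b) (u : a → ℂ),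
      inner ℂ y (WithLp.toLp 2 (Yᴴ *ᵥ u)) = star (Y *ᵥ y.ofLp) ⬝ᵥ u := by
    intro Y y u
    rw [← WithLp.toLp_ofLp 2 y, EuclideanSpace.inner_toLp_toLp, dotProduct_comm, star_mulVec,
      dotProduct_mulVec]
  obtain ⟨T, hT⟩ := exists_linearIsometry_of_norm_eq f g fun u => by
    have h1 : ∀ Y : Matrix a b ℂ, inner ℂ (WithLp.toLp 2 (Yᴴ *ᵥ u)) (WithLp.toLp 2 (Yᴴ *ᵥ u)) =
        star ((Y * Yᴴ) *ᵥ u) ⬝ᵥ u := by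
      intro Y
      rw [hinner, mulVec_mulVec]
    have h2 : inner ℂ (f u) (f u) = inner ℂ (g u) (g u) := by
      change inner ℂ (WithLp.toLp 2 (Xcᴴ *ᵥ u)) (WithLp.toLp 2 (Xcᴴ *ᵥ u)) =
        inner ℂ (WithLp.toLp 2 (Vcᴴ *ᵥ u)) (WithLp.toLp 2 (Vcᴴ *ᵥ u))
      rw [h1, h1, hc]
    rw [inner_self_eq_norm_sq_to_K, inner_self_eq_norm_sq_to_K] at h2
    have h3 : ‖f u‖ ^ 2 = ‖g u‖ ^ 2 := by exact_mod_cast h2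
    exact (pow_left_inj₀ (norm_nonneg _) (norm_nonneg _) two_ne_zero).1 h3
  obtain ⟨e, z, hez⟩ := T.exists_orthonormalBasis_eigenvectors
    (r := Fintype.card b) finrank_euclideanSpace
  have hz : ∀ k, ‖z k‖ = 1 := fun k => by
    have h1 := T.norm_map (e k)
    rwa [hez, norm_smul, e.norm_eq_one, mul_one] at h1
  refine ⟨e, fun k => (z k)⁻¹, fun k => ⟨by rw [norm_inv, hz, inv_one], ?_⟩⟩
  have hz0 : z k ≠ 0 := fun h0 => by simpa [h0] using hz k
  -- `V eₖ = X Tᴴ eₖ`, tested against an arbitrary vector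
  have key : ∀ u : a → ℂ, star (Vc *ᵥ (e k).ofLp) ⬝ᵥ u = star ((z k)⁻¹ • (Xc *ᵥ (e k).ofLp)) ⬝ᵥ u := by
    intro u
    have h1 : e k = T ((z k)⁻¹ • e k) := by
      rw [map_smul, hez, smul_smul, inv_mul_cancel₀ hz0, one_smul]
    have h2 : inner ℂ (e k) (g u) = inner ℂ ((z k)⁻¹ • e k) (f u) := by
      conv_lhs => rw [h1, ← hT u]
      rw [T.inner_map_map]
    have h3 : inner ℂ (e k) (g u) = star (Vc *ᵥ (e k).ofLp) ⬝ᵥ u := hinner Vc (e k) u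
    have h4 : inner ℂ (e k) (f u) = star (Xc *ᵥ (e k).ofLp) ⬝ᵥ u := hinner Xc (e k) u
    rw [← h3, h2, inner_smul_left, h4, star_smul, smul_dotProduct, smul_eq_mul]
    rfl
  have h6 := dotProduct_eq _ _ key
  exact star_injective h6

theorem quadForm_fromBlocks_diag {a b : Type*} [Fintype a] [Fintype b] (Q : Matrix a a ℝ)
    (N : Matrix b b ℝ) (y : a ⊕ b → ℝ) :
    quadForm (fromBlocks Q 0 0 N) y = quadForm Q (y ∘ Sum.inl) + quadForm N (y ∘ Sum.inr) := by
  rw [quadForm, fromBlocks_mulVec, dotProduct, Fintype.sum_sum_type]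
  simp [quadForm, dotProduct]

variable {p q : ℕ}

/-- A frequency-domain inequality on the unit circle excludes the nonzero matrices `Z = Y Yᵀ`
that are stationary for `(A, D)` and violate the inequality on average. -/
theorem eq_zero_of_frequency_inequality {A Q : Matrix (Fin p) (Fin p) ℝ}
    {D : Matrix (Fin p) (Fin q) ℝ} {g : ℝ}
    (h : ∀ (z : ℂ) (x : Fin p → ℂ) (w : Fin q → ℂ), ‖z‖ = 1 →
      z • x = toComplex A *ᵥ x + toComplex D *ᵥ w → (x ≠ 0 ∨ w ≠ 0) →
      hermForm Q x < g * hermForm 1 w) {κ : Type*} [Fintype κ] [DecidableEq κ]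
    {Y : Matrix (Fin p ⊕ Fin q) κ ℝ}
    (hst : (fromCols A D * Y) * (fromCols A D * Y)ᵀ =
      ((fromCols 1 0 : Matrix (Fin p) (Fin p ⊕ Fin q) ℝ) * Y) *
        ((fromCols 1 0 : Matrix (Fin p) (Fin p ⊕ Fin q) ℝ) * Y)ᵀ)
    (htr : 0 ≤ (Yᵀ * (fromBlocks Q 0 0 (-(g • 1)) :
      Matrix (Fin p ⊕ Fin q) (Fin p ⊕ Fin q) ℝ) * Y).trace) : Y = 0 := by
  obtain ⟨e, z, hez⟩ := exists_orthonormalBasis_of_mul_transpose_eq hst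
  set y : Fin (Fintype.card κ) → (Fin p ⊕ Fin q → ℂ) :=
    fun k => Y.map (algebraMap ℝ ℂ) *ᵥ (e k).ofLp with hy
  have hherm : ∀ v : Fin p ⊕ Fin q → ℂ, hermForm (fromBlocks Q 0 0 (-(g • 1))) v =
      hermForm Q (v ∘ Sum.inl) - g * hermForm 1 (v ∘ Sum.inr) := fun v => by
    rw [hermForm, quadForm_fromBlocks_diag, quadForm_fromBlocks_diag, ← neg_smul,
      quadForm_matrix_smul, quadForm_matrix_smul, hermForm, hermForm]
    change quadForm Q (vecRe (v ∘ Sum.inl)) + -g * quadForm 1 (vecRe (v ∘ Sum.inr)) +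
      (quadForm Q (vecIm (v ∘ Sum.inl)) + -g * quadForm 1 (vecIm (v ∘ Sum.inr))) = _
    ring
  have hdyn : ∀ k, z k • (y k ∘ Sum.inl) =
      toComplex A *ᵥ (y k ∘ Sum.inl) + toComplex D *ᵥ (y k ∘ Sum.inr) := fun k => by
    have h1 := (hez k).2
    have h2 : (fromCols A D).map (algebraMap ℝ ℂ) = fromCols (toComplex A) (toComplex D) := by
      ext i (j | j) <;> rfl
    have h3 : (fromCols 1 0 : Matrix (Fin p) (Fin p ⊕ Fin q) ℝ).map (algebraMap ℝ ℂ) =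
        fromCols 1 0 := by
      ext i (j | j)
      · by_cases hij : i = j <;> simp [hij]
      · simp
    rw [Matrix.map_mul, Matrix.map_mul, ← mulVec_mulVec, ← mulVec_mulVec, h2, h3,
      fromCols_mulVec, fromCols_mulVec, one_mulVec, zero_mulVec, add_zero] at h1
    exact h1.symm
  have hneg : ∀ k, y k ≠ 0 → hermForm (fromBlocks Q 0 0 (-(g • 1))) (y k) < 0 := fun k hk => by
    rw [hherm, sub_neg]
    refine h (z k) _ _ (hez k).1 (hdyn k) ?_
    by_contra! hcon
    refine hk (funext fun i => ?_)
    rcases i with i | i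
    · exact congrFun hcon.1 i
    · exact congrFun hcon.2 i
  have hzero : ∀ k, y k = 0 := by
    by_contra! hcon
    obtain ⟨k, hk⟩ := hcon
    rw [← sum_hermForm_orthonormalBasis e] at htr
    refine htr.not_gt (Finset.sum_neg' (fun j _ => ?_) ⟨k, Finset.mem_univ k, ?_⟩)
    · rw [← hermForm_map_mulVec]
      by_cases hj : y j = 0
      · change hermForm _ (y j) ≤ 0
        rw [hj]
        simp [hermForm, vecRe, vecIm, quadForm, dotProduct]
      · exact (hneg j hj).le
    · rw [← hermForm_map_mulVec]
      exact hneg k hk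
  have h1 : (Yᵀ * Y).trace = 0 := by
    rw [← sum_hermForm_orthonormalBasis e]
    refine Finset.sum_eq_zero fun k _ => ?_
    have h2 := hermForm_map_mulVec 1 Y (e k).ofLp
    rw [Matrix.mul_one] at h2
    rw [← h2]
    change hermForm _ (y k) = 0
    rw [hzero]
    simp [hermForm, vecRe, vecIm, quadForm, dotProduct]
  have h2 : Yᴴ = Yᵀ := by ext i j; simp
  rw [← h2] at h1
  exact trace_conjTranspose_mul_self_eq_zero_iff.1 h1

section

open scoped MatrixOrder

theorem Matrix.PosSemidef.exists_eq_mul_transpose {a : Type*} [Fintype a] [DecidableEq a]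
    {Z : Matrix a a ℝ} (hZ : Z.PosSemidef) : ∃ Y : Matrix a a ℝ, Z = Y * Yᵀ := by
  have h1 : (CFC.sqrt Z).PosSemidef := nonneg_iff_posSemidef.1 (CFC.sqrt_nonneg _)
  refine ⟨CFC.sqrt Z, ?_⟩
  rw [h1.isSymm.eq]
  exact (CFC.sqrt_mul_sqrt_self _ (nonneg_iff_posSemidef.2 hZ)).symm

end

theorem isCompact_posSemidef_trace_eq_one {a : Type*} [Fintype a] [DecidableEq a] :
    IsCompact {Z : Matrix a a ℝ | Z.PosSemidef ∧ Z.trace = 1} := by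
  have hbox : IsCompact (Set.univ.pi fun _ : a => Set.univ.pi fun _ : a => Set.Icc (-1 : ℝ) 1) :=
    isCompact_univ_pi fun _ => isCompact_univ_pi fun _ => isCompact_Icc
  refine IsCompact.of_isClosed_subset hbox ?_ ?_
  · have h1 : {Z : Matrix a a ℝ | Z.PosSemidef ∧ Z.trace = 1} =
        ({Z : Matrix a a ℝ | Zᵀ = Z} ∩ ⋂ x : a → ℝ, {Z | 0 ≤ quadForm Z x}) ∩
          {Z | Z.trace = 1} := by
      ext Z
      simp [posSemidef_iff_quadForm, IsSymm]
    rw [h1]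
    refine ((isClosed_eq (by fun_prop) (by fun_prop)).inter (isClosed_iInter fun x => ?_)).inter
      (isClosed_eq (by fun_prop) (by fun_prop))
    exact isClosed_le continuous_const (continuous_quadForm_left x)
  · rintro Z ⟨hZ, htr⟩ i - j -
    have hdiag : ∀ k, Z k k ≤ 1 := fun k => by
      rw [← htr]
      exact Finset.single_le_sum (f := fun k => Z k k) (fun k _ => hZ.diag_nonneg)
        (Finset.mem_univ k)
    have h1 := hZ.quadForm_nonneg (Pi.single i 1 + Pi.single j 1)
    have h2 := hZ.quadForm_nonneg (Pi.single i 1 - Pi.single j 1)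
    rw [quadForm_add hZ.isSymm] at h1
    rw [quadForm_sub hZ.isSymm] at h2
    simp only [quadForm, mulVec_single_one, single_one_dotProduct, col_apply] at h1 h2
    constructor <;> linarith [hdiag i, hdiag j]

/-- A linear functional on matrices evaluates rank-one matrices through a quadratic form. -/
theorem exists_isSymm_quadForm_eq {a : Type*} [Fintype a] [DecidableEq a]
    (f : Matrix a a ℝ →ₗ[ℝ] ℝ) :
    ∃ P : Matrix a a ℝ, P.IsSymm ∧ ∀ x, f (vecMulVec x x) = quadForm P x := by
  let P₀ : Matrix a a ℝ := Matrix.of fun i j => f (Matrix.single i j 1)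
  have h0 : ∀ x, f (vecMulVec x x) = quadForm P₀ x := fun x => by
    conv_lhs => rw [matrix_eq_sum_single (vecMulVec x x)]
    simp only [map_sum, quadForm, dotProduct, mulVec, Finset.mul_sum]
    refine Finset.sum_congr rfl fun i _ => Finset.sum_congr rfl fun j _ => ?_
    have : Matrix.single i j (vecMulVec x x i j) = (x i * x j) • Matrix.single i j (1 : ℝ) := by
      rw [smul_single, smul_eq_mul, mul_one, vecMulVec_apply]
    rw [this, map_smul, smul_eq_mul]
    simp only [P₀, of_apply]
    ring
  refine ⟨(1 / 2 : ℝ) • (P₀ + P₀ᵀ), ?_, fun x => ?_⟩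
  · simp [IsSymm, add_comm]
  · have h1 : quadForm P₀ᵀ x = quadForm P₀ x := by
      rw [quadForm, dotProduct_mulVec_transpose, transpose_transpose, dotProduct_comm, quadForm]
    rw [h0, quadForm_matrix_smul, quadForm_matrix_add, h1]
    ring

/-- The strict Kalman-Yakubovich-Popov lemma on the unit circle: a frequency-domain inequality
is certified by a quadratic storage function, found by separating the (compact, convex) set of
second moments `Z ≥ 0`, `tr Z = 1`, from the stationary ones. -/
theorem exists_storage_of_frequency_inequality {A Q : Matrix (Fin p) (Fin p) ℝ}
    {D : Matrix (Fin p) (Fin q) ℝ} {g : ℝ}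
    (h : ∀ (z : ℂ) (x : Fin p → ℂ) (w : Fin q → ℂ), ‖z‖ = 1 →
      z • x = toComplex A *ᵥ x + toComplex D *ᵥ w → (x ≠ 0 ∨ w ≠ 0) →
      hermForm Q x < g * hermForm 1 w) :
    ∃ P : Matrix (Fin p) (Fin p) ℝ, P.IsSymm ∧ ∃ e : ℝ, 0 < e ∧
      ∀ (x : Fin p → ℝ) (w : Fin q → ℝ), quadForm P (A *ᵥ x + D *ᵥ w) + quadForm Q x +
        e * (x ⬝ᵥ x + w ⬝ᵥ w) ≤ quadForm P x + g * (w ⬝ᵥ w) := by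
  set F := fromCols A D with hF
  set G : Matrix (Fin p) (Fin p ⊕ Fin q) ℝ := fromCols 1 0 with hG
  set N : Matrix (Fin p ⊕ Fin q) (Fin p ⊕ Fin q) ℝ := fromBlocks Q 0 0 (-(g • 1)) with hN
  -- the stationarity defect and the cost of a second moment matrix
  let φ : Matrix (Fin p ⊕ Fin q) (Fin p ⊕ Fin q) ℝ →ₗ[ℝ] (Fin p → Fin p → ℝ) × ℝ :=
    { toFun := fun Z => (F * Z * Fᵀ - G * Z * Gᵀ, (N * Z).trace)
      map_add' := fun Z Z' => by
        ext1
        · simp only [Matrix.mul_add, Matrix.add_mul, Prod.fst_add]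
          exact add_sub_add_comm _ _ _ _
        · simp [Matrix.mul_add]
      map_smul' := fun c Z => by
        ext1
        · simp only [Matrix.mul_smul, Matrix.smul_mul, RingHom.id_apply, Prod.smul_fst]
          exact (smul_sub c _ _).symm
        · simp }
  have hφ : ∀ Z, φ Z = (F * Z * Fᵀ - G * Z * Gᵀ, (N * Z).trace) := fun Z => rfl
  let M : Set (Matrix (Fin p ⊕ Fin q) (Fin p ⊕ Fin q) ℝ) := {Z | Z.PosSemidef ∧ Z.trace = 1}
  have hMconv : Convex ℝ M := by
    rintro Z ⟨hZ, hZ1⟩ Z' ⟨hZ', hZ1'⟩ s t hs ht hst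
    refine ⟨(hZ.smul hs).add (hZ'.smul ht), ?_⟩
    rw [trace_add, trace_smul, trace_smul, hZ1, hZ1', smul_eq_mul, smul_eq_mul, mul_one, mul_one,
      hst]
  have hMcomp : IsCompact M := isCompact_posSemidef_trace_eq_one
  have hφc : Continuous φ := φ.continuous_of_finiteDimensional
  have hdisj : Disjoint (φ '' M) ({0} ×ˢ Set.Ici 0) := by
    rw [Set.disjoint_left]
    rintro _ ⟨Z, hZ, rfl⟩ ⟨h1, h2⟩
    obtain ⟨Y, rfl⟩ := hZ.1.exists_eq_mul_transpose
    have h3 : F * (Y * Yᵀ) * Fᵀ - G * (Y * Yᵀ) * Gᵀ = 0 := h1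
    have h4 : 0 ≤ (N * (Y * Yᵀ)).trace := h2
    have h5 : Y = 0 := by
      refine eq_zero_of_frequency_inequality h (sub_eq_zero.1 ?_) ?_
      · rw [← h3]
        simp only [transpose_mul, Matrix.mul_assoc, hF, hG]
      · rwa [← Matrix.mul_assoc, trace_mul_comm, ← Matrix.mul_assoc] at h4
    have h6 := hZ.2
    simp [h5] at h6
  obtain ⟨f, u, v, hfu, huv, hfv⟩ := geometric_hahn_banach_compact_closed
    (hMconv.is_linear_image φ.isLinear) (hMcomp.image hφc)
    ((convex_singleton 0).prod (convex_Ici 0)) (isClosed_singleton.prod isClosed_Ici) hdisj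
  have hv : v < 0 := by
    have h1 := hfv 0 ⟨rfl, Set.mem_Ici.2 le_rfl⟩
    rwa [map_zero] at h1
  have hu : u < 0 := huv.trans hv
  set τ := f (0, 1) with hτ
  have hτ0 : 0 ≤ τ := by
    by_contra! hneg
    have h1 := hfv (0, v / τ) (by simp [div_nonneg_of_nonpos hv.le hneg.le])
    have h2 : ((0, v / τ) : (Fin p → Fin p → ℝ) × ℝ) = (v / τ) • (0, 1) := by simp
    rw [h2, map_smul, smul_eq_mul, div_mul_cancel₀ _ hneg.ne] at h1
    exact lt_irrefl _ h1
  obtain ⟨P, hP, hPf⟩ := exists_isSymm_quadForm_eq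
    (f.toLinearMap ∘ₗ LinearMap.inl ℝ (Fin p → Fin p → ℝ) ℝ)
  -- the multiplier `τ` of the cost may vanish; a small increase keeps the separation strict
  obtain ⟨c, hc⟩ : ∃ c : ℝ, ∀ Z ∈ M, (N * Z).trace ≤ c := by
    have hcont : Continuous fun Z : Matrix (Fin p ⊕ Fin q) (Fin p ⊕ Fin q) ℝ => (N * Z).trace := by
      fun_prop
    obtain ⟨c, hc⟩ := hMcomp.bddAbove_image hcont.continuousOn
    exact ⟨c, fun Z hZ => hc ⟨Z, hZ, rfl⟩⟩
  set δ := -u / (2 * (|c| + 1)) with hδ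
  have hc1 : 0 < |c| + 1 := by positivity
  have hδ0 : 0 < δ := div_pos (neg_pos.2 hu) (by positivity)
  have hδc : δ * c ≤ -u / 2 := by
    have h1 : δ * (|c| + 1) = -u / 2 := by rw [hδ]; field_simp
    have h2 : δ * c ≤ δ * (|c| + 1) :=
      mul_le_mul_of_nonneg_left (by linarith [le_abs_self c]) hδ0.le
    linarith
  have hσ : 0 < τ + δ := by linarith
  have key : ∀ (x : Fin p → ℝ) (w : Fin q → ℝ), quadForm P (A *ᵥ x + D *ᵥ w) - quadForm P x +
      (τ + δ) * (quadForm Q x - g * (w ⬝ᵥ w)) ≤ u / 2 * (x ⬝ᵥ x + w ⬝ᵥ w) := by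
    intro x w
    set y : Fin p ⊕ Fin q → ℝ := Sum.elim x w with hy
    set s := x ⬝ᵥ x + w ⬝ᵥ w with hs
    have hys : y ⬝ᵥ y = s := by
      rw [dotProduct, Fintype.sum_sum_type]; rfl
    have hs0 : 0 ≤ s := add_nonneg (dotProduct_self_nonneg x) (dotProduct_self_nonneg w)
    rcases hs0.eq_or_lt with h0 | hs1
    · have hx : x = 0 := dotProduct_self_eq_zero.1
        (by linarith [dotProduct_self_nonneg x, dotProduct_self_nonneg w])
      have hw : w = 0 := dotProduct_self_eq_zero.1
        (by linarith [dotProduct_self_nonneg x, dotProduct_self_nonneg w])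
      rw [← h0, hx, hw]
      simp [quadForm]
    have hZ : s⁻¹ • vecMulVec y y ∈ M := by
      refine ⟨PosSemidef.smul ?_ (inv_nonneg.2 hs0), ?_⟩
      · simpa using posSemidef_vecMulVec_self_star y
      · rw [trace_smul, trace_vecMulVec, hys, smul_eq_mul, inv_mul_cancel₀ hs1.ne']
    have hconj : ∀ L : Matrix (Fin p) (Fin p ⊕ Fin q) ℝ,
        L * vecMulVec y y * Lᵀ = vecMulVec (L *ᵥ y) (L *ᵥ y) := fun L => by
      rw [mul_vecMulVec, vecMulVec_mul, vecMul_transpose]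
    have hFy : F *ᵥ y = A *ᵥ x + D *ᵥ w := by
      rw [hF, fromCols_mulVec]; rfl
    have hGy : G *ᵥ y = x := by
      rw [hG, fromCols_mulVec, one_mulVec, zero_mulVec, add_zero]; rfl
    have hNy : (N * vecMulVec y y).trace = quadForm Q x - g * (w ⬝ᵥ w) := by
      rw [← quadForm_eq_trace, hN, quadForm_fromBlocks_diag, ← neg_smul, quadForm_matrix_smul,
        quadForm_one, sub_eq_add_neg, ← neg_mul]
      rfl
    have hfφ : f (φ (vecMulVec y y)) = quadForm P (A *ᵥ x + D *ᵥ w) - quadForm P x +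
        τ * (quadForm Q x - g * (w ⬝ᵥ w)) := by
      rw [hφ, hconj, hconj, hFy, hGy, hNy, ← hPf, ← hPf, hτ]
      have h1 : ∀ (V V' : Fin p → Fin p → ℝ) (t : ℝ), ((V - V', t) : (Fin p → Fin p → ℝ) × ℝ) =
          LinearMap.inl ℝ (Fin p → Fin p → ℝ) ℝ V - LinearMap.inl ℝ (Fin p → Fin p → ℝ) ℝ V' +
            t • (0, 1) := fun V V' t => by simp
      refine (congrArg f (h1 _ _ _)).trans ?_
      rw [map_add, map_sub, map_smul, smul_eq_mul, mul_comm (f (0, 1))]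
      rfl
    have h1 := hfu _ ⟨_, hZ, rfl⟩
    have h2 := hc _ hZ
    rw [map_smul, map_smul, hfφ, smul_eq_mul, inv_mul_lt_iff₀ hs1] at h1
    rw [Matrix.mul_smul, trace_smul, hNy, smul_eq_mul, inv_mul_le_iff₀ hs1] at h2
    have h3 := mul_le_mul_of_nonneg_left h2 hδ0.le
    have h4 := mul_le_mul_of_nonneg_left hδc hs0
    nlinarith
  refine ⟨(τ + δ)⁻¹ • P, hP.smul _, (τ + δ)⁻¹ * (-u / 2),
    mul_pos (inv_pos.2 hσ) (by linarith), fun x w => ?_⟩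
  have h1 := mul_le_mul_of_nonneg_left (key x w) (inv_nonneg.2 hσ.le)
  rw [mul_add, inv_mul_cancel_left₀ hσ.ne'] at h1
  rw [quadForm_matrix_smul, quadForm_matrix_smul]
  linarith

end KYP

namespace MixedDesign

variable {m d n l : ℕ} {S : MixedDesign m d n l} {K : Matrix (Fin d) (Fin m) ℝ}
  {P X : Matrix (Fin m) (Fin m) ℝ}

/-! ### Well-posedness of the Riccati equation on the feasible set -/

theorem opNorm_transfer_lt (hγ : 0 < S.γ) (hK : K ∈ S.feasible) {z : ℂ} (hz : ‖z‖ = 1) :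
    opNorm (S.transfer K z) < S.γ := by
  obtain ⟨t, rfl⟩ := (Complex.norm_eq_one_iff z).1 hz
  have hmem := toIcoMod_mem_Ico' Real.two_pi_pos t
  have hexp : Complex.exp (Complex.I * ((toIcoMod Real.two_pi_pos 0 t : ℝ) : ℂ)) =
      Complex.exp (t * Complex.I) := by
    have h1 : (toIcoMod Real.two_pi_pos 0 t : ℝ) =
        t - (toIcoDiv Real.two_pi_pos 0 t : ℝ) * (2 * Real.pi) := by
      rw [toIcoMod, zsmul_eq_mul]
    rw [Complex.exp_eq_exp_iff_exists_int]
    refine ⟨-toIcoDiv Real.two_pi_pos 0 t, ?_⟩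
    rw [h1]
    push_cast
    ring
  have h1 := (le_iSup₂ (f := fun (θ : ℝ) (_ : θ ∈ Set.Ico (0 : ℝ) (2 * Real.pi)) =>
    ENNReal.ofReal (opNorm (S.transfer K (Complex.exp (Complex.I * (θ : ℂ)))))) _
      hmem).trans_lt hK.2
  rw [hexp] at h1
  exact (ENNReal.ofReal_lt_ofReal_iff hγ).1 h1

/-- Necessity in the strict bounded real lemma. -/
theorem exists_strictDissipation (hR : S.R.PosDef) (hγ : 0 < S.γ) (hK : K ∈ S.feasible) :
    ∃ X, S.StrictDissipation K X := by
  obtain ⟨X, hX, e, he, h⟩ := exists_storage_of_frequency_inequality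
    (A := S.closedLoop K) (Q := S.weight K) (D := S.D) (g := S.γ ^ 2) (by
      intro z x w hz hzx hne
      rw [← transfer_mulVec hR hK.1 hz.ge hzx, hermForm_one_eq_sum (S.transfer K z *ᵥ w)]
      have hw : w ≠ 0 := by
        rintro rfl
        rcases hne with hx | hw
        · rw [mulVec_zero, add_zero] at hzx
          exact (specRad_lt_one_iff.1 hK.1 z x hx hzx.symm).ne hz
        · exact hw rfl
      refine (sum_norm_mulVec_sq_le _ w).trans_lt ?_
      rw [← hermForm_one_eq_sum]
      exact mul_lt_mul_of_pos_right
        (pow_lt_pow_left₀ (opNorm_transfer_lt hγ hK hz) (opNorm_nonneg _) two_ne_zero)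
        (hermForm_one_pos hw))
  refine ⟨X, posSemidef_of_quadForm_mulVec_le hK.1 hX fun x => ?_, e, he, h⟩
  have h1 := h x 0
  simp only [mulVec_zero, add_zero, dotProduct_zero, mul_zero] at h1
  have h2 := mul_nonneg he.le (dotProduct_self_nonneg x)
  linarith [(weight_posSemidef hR K).quadForm_nonneg x]

theorem existsUnique_isStabilizingSolution (hR : S.R.PosDef) (hγ : 0 < S.γ)
    (hK : K ∈ S.feasible) : ∃! P, S.IsStabilizingSolution K P := by
  obtain ⟨X, hX⟩ := exists_strictDissipation hR hγ hK
  obtain ⟨P, hP⟩ := hX.exists_isStabilizingSolution hR hγ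
  exact ⟨P, hP, fun P' hP' => hP'.unique hγ hP⟩

theorem isStabilizingSolution_ricSol (hR : S.R.PosDef) (hγ : 0 < S.γ) (hK : K ∈ S.feasible) :
    S.IsStabilizingSolution K (S.ricSol K) := by
  have h := (existsUnique_isStabilizingSolution hR hγ hK).exists
  rw [ricSol, dif_pos h]
  exact h.choose_spec

/-! ### One step of policy improvement -/

theorem quadForm_hess (P : Matrix (Fin m) (Fin m) ℝ) (y : Fin d → ℝ) :
    quadForm (S.hess P) y = quadForm S.R y + quadForm (S.tilde P) (S.B *ᵥ y) := by
  rw [hess, quadForm_matrix_add, quadForm_congr]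

theorem hess_posDef (hR : S.R.PosDef) (hP : P.PosSemidef) (hΛ : (S.slack P).PosDef) :
    (S.hess P).PosDef :=
  hR.add_posSemidef (posSemidef_iff_quadForm.2
    ⟨by simp [IsSymm, (tilde_isSymm (S := S) hP.isSymm).eq, Matrix.mul_assoc], fun y => by
      rw [quadForm_congr]; exact (tilde_posSemidef hP hΛ).quadForm_nonneg _⟩)

theorem closedLoop_sub_mulVec (K Z : Matrix (Fin d) (Fin m) ℝ) (x : Fin m → ℝ) :
    S.closedLoop (K - Z) *ᵥ x = S.closedLoop K *ᵥ x + S.B *ᵥ (Z *ᵥ x) := by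
  rw [closedLoop, closedLoop, Matrix.mul_sub, mulVec_mulVec, ← add_mulVec]
  congr 1
  abel

theorem quadForm_weight_sub (hR : S.R.PosDef) (K Z : Matrix (Fin d) (Fin m) ℝ) (x : Fin m → ℝ) :
    quadForm (S.weight (K - Z)) x = quadForm (S.weight K) x -
      2 * ((K *ᵥ x) ⬝ᵥ S.R *ᵥ (Z *ᵥ x)) + quadForm S.R (Z *ᵥ x) := by
  rw [quadForm_weight, quadForm_weight, sub_mulVec, quadForm_sub hR.isSymm]
  ring

/-- The Riccati operator is quadratic in the gain. -/
theorem quadForm_ricOp_sub (hR : S.R.PosDef) (hP : P.IsSymm) (K Z : Matrix (Fin d) (Fin m) ℝ)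
    (x : Fin m → ℝ) : quadForm (S.ricOp (K - Z) P) x = quadForm (S.ricOp K P) x -
      2 * ((Z *ᵥ x) ⬝ᵥ (S.hess P * K - S.Bᵀ * S.tilde P * S.A) *ᵥ x) +
      quadForm (S.hess P) (Z *ᵥ x) := by
  have hT := tilde_isSymm (S := S) hP
  have h1 : S.hess P * K - S.Bᵀ * S.tilde P * S.A =
      S.R * K - S.Bᵀ * S.tilde P * S.closedLoop K := by
    rw [hess, closedLoop, Matrix.add_mul, Matrix.mul_sub, Matrix.mul_assoc _ S.B K]
    abel
  have h2 : (Z *ᵥ x) ⬝ᵥ (S.R * K) *ᵥ x = (K *ᵥ x) ⬝ᵥ S.R *ᵥ (Z *ᵥ x) := by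
    rw [← mulVec_mulVec, hR.isSymm.dotProduct_mulVec_comm]
  have h3 : (Z *ᵥ x) ⬝ᵥ (S.Bᵀ * S.tilde P * S.closedLoop K) *ᵥ x =
      (S.closedLoop K *ᵥ x) ⬝ᵥ S.tilde P *ᵥ (S.B *ᵥ (Z *ᵥ x)) := by
    rw [← mulVec_mulVec, ← mulVec_mulVec, dotProduct_mulVec_transpose, transpose_transpose,
      hT.dotProduct_mulVec_comm]
  rw [quadForm_ricOp, quadForm_ricOp, closedLoop_sub_mulVec, quadForm_add hT,
    quadForm_weight_sub hR, quadForm_hess, h1, sub_mulVec, dotProduct_sub, h2, h3]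
  ring

/-- The preconditioner `N` makes `K ↦ K - N E_K` decrease the Riccati operator at least by
`c E_Kᵀ E_K`; here `H` is the matrix `R + Bᵀ P̃_K B`. -/
def IsDescentPreconditioner (H N : Matrix (Fin d) (Fin d) ℝ) (c : ℝ) : Prop :=
  ∀ y, c * (y ⬝ᵥ y) ≤ 2 * (y ⬝ᵥ N *ᵥ y) - quadForm H (N *ᵥ y)

theorem quadForm_ricOp_descent (hR : S.R.PosDef) (hγ : 0 < S.γ) (hK : K ∈ S.feasible)
    {N : Matrix (Fin d) (Fin d) ℝ} {c : ℝ}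
    (hN : IsDescentPreconditioner (S.hess (S.ricSol K)) N c) (x : Fin m → ℝ) :
    quadForm (S.ricOp (K - N * S.E K) (S.ricSol K)) x +
      c * ((S.E K *ᵥ x) ⬝ᵥ (S.E K *ᵥ x)) ≤ quadForm (S.ricSol K) x := by
  obtain ⟨hP, hfix, -, -⟩ :=
    (isStabilizingSolution_iff hγ).1 (isStabilizingSolution_ricSol hR hγ hK)
  rw [quadForm_ricOp_sub hR hP.isSymm, hfix, ← mulVec_mulVec]
  have h1 := hN (S.E K *ᵥ x)
  have h2 : (N *ᵥ (S.E K *ᵥ x)) ⬝ᵥ (S.hess (S.ricSol K) * K -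
      S.Bᵀ * S.tilde (S.ricSol K) * S.A) *ᵥ x = (S.E K *ᵥ x) ⬝ᵥ N *ᵥ (S.E K *ᵥ x) := by
    rw [dotProduct_comm]; rfl
  rw [h2]
  linarith

/-- Subtracting `N E` from the gain spoils the strict dissipation inequality at most by a
multiple of `|E x|²`. -/
theorem StrictDissipation.exists_perturbed (hR : S.R.PosDef) (h : S.StrictDissipation K X)
    (N : Matrix (Fin d) (Fin d) ℝ) (E : Matrix (Fin d) (Fin m) ℝ) :
    ∃ e : ℝ, 0 < e ∧ ∃ c : ℝ, 0 ≤ c ∧ ∀ (x : Fin m → ℝ) (w : Fin n → ℝ),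
      quadForm X (S.closedLoop (K - N * E) *ᵥ x + S.D *ᵥ w) + quadForm (S.weight (K - N * E)) x +
        e * (x ⬝ᵥ x + w ⬝ᵥ w) ≤
      quadForm X x + S.γ ^ 2 * (w ⬝ᵥ w) + c * ((E *ᵥ x) ⬝ᵥ (E *ᵥ x)) := by
  obtain ⟨hX, e, he, h⟩ := h
  have he2 : 0 < e / 2 := half_pos he
  obtain ⟨c₁, hc₁, h₁⟩ := exists_two_mul_dotProduct_mulVec_le
    (((S.closedLoop K)ᵀ * X * S.B - Kᵀ * S.R) * N) he2
  obtain ⟨c₂, hc₂, h₂⟩ := exists_two_mul_dotProduct_mulVec_le (S.Dᵀ * X * S.B * N) he2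
  obtain ⟨c₃, hc₃, h₃⟩ := exists_quadForm_le (Nᵀ * (S.Bᵀ * X * S.B + S.R) * N)
  refine ⟨e / 2, he2, c₁ + c₂ + c₃, by positivity, fun x w => ?_⟩
  set y := E *ᵥ x with hy
  have hv : (N * E) *ᵥ x = N *ᵥ y := by rw [hy, mulVec_mulVec]
  have g1 := h x w
  have g2 := h₁ x y
  have g3 := h₂ w y
  have g4 := h₃ y
  have e2 : x ⬝ᵥ (((S.closedLoop K)ᵀ * X * S.B - Kᵀ * S.R) * N) *ᵥ y =
      (S.closedLoop K *ᵥ x) ⬝ᵥ X *ᵥ (S.B *ᵥ (N *ᵥ y)) - (K *ᵥ x) ⬝ᵥ S.R *ᵥ (N *ᵥ y) := by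
    rw [← mulVec_mulVec, sub_mulVec, dotProduct_sub, ← mulVec_mulVec, ← mulVec_mulVec,
      ← mulVec_mulVec, dotProduct_mulVec_transpose, transpose_transpose,
      dotProduct_mulVec_transpose Kᵀ, transpose_transpose]
  have e3 : w ⬝ᵥ (S.Dᵀ * X * S.B * N) *ᵥ y = (S.D *ᵥ w) ⬝ᵥ X *ᵥ (S.B *ᵥ (N *ᵥ y)) := by
    rw [← mulVec_mulVec, ← mulVec_mulVec, ← mulVec_mulVec, dotProduct_mulVec_transpose,
      transpose_transpose]
  rw [e2] at g2
  rw [e3] at g3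
  rw [quadForm_congr, quadForm_matrix_add, quadForm_congr] at g4
  rw [closedLoop_sub_mulVec, quadForm_weight_sub hR, hv, add_right_comm (S.closedLoop K *ᵥ x),
    quadForm_add hX.isSymm, add_dotProduct]
  linarith

/-- A policy improvement step preserves feasibility: for small `s`, the matrix
`(1 - s) P_K + s X` certifies the new gain, where `X` certifies `K`. -/
theorem sub_mul_mem_feasible (hR : S.R.PosDef) (hγ : 0 < S.γ) (hK : K ∈ S.feasible)
    {N : Matrix (Fin d) (Fin d) ℝ} {c : ℝ} (hc : 0 < c)
    (hN : IsDescentPreconditioner (S.hess (S.ricSol K)) N c) :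
    K - N * S.E K ∈ S.feasible := by
  obtain ⟨hP, hfix, hΛ, -⟩ :=
    (isStabilizingSolution_iff hγ).1 (isStabilizingSolution_ricSol hR hγ hK)
  obtain ⟨X, hX⟩ := exists_strictDissipation hR hγ hK
  obtain ⟨e, he, c', hc', h⟩ := hX.exists_perturbed hR N (S.E K)
  set P := S.ricSol K with hPdef
  set K' := K - N * S.E K with hK'
  -- the weight `s` balances the gain `c` at `P` against the loss `c'` at `X`
  set s := c / (c + c') with hs
  have hcc : 0 < c + c' := by linarith
  have hs0 : 0 < s := div_pos hc hcc
  have hs1 : 0 ≤ 1 - s := by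
    rw [sub_nonneg, hs, div_le_one hcc]; linarith
  have hbal : (1 - s) * c = s * c' := by rw [hs]; field_simp; ring
  refine StrictDissipation.mem_feasible (X := (1 - s) • P + s • X) hR hγ
    ⟨(hP.smul hs1).add (hX.1.smul hs0.le), s * e, mul_pos hs0 he, fun x w => ?_⟩
  have h1 := quadForm_ricOp_descent hR hγ hK hN x
  rw [quadForm_ricOp] at h1
  have h2 := quadForm_add_mulVec_D_le hP.isSymm hΛ (S.closedLoop K' *ᵥ x) w
  have h3 : quadForm P (S.closedLoop K' *ᵥ x + S.D *ᵥ w) + quadForm (S.weight K') x ≤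
      quadForm P x + S.γ ^ 2 * (w ⬝ᵥ w) - c * ((S.E K *ᵥ x) ⬝ᵥ (S.E K *ᵥ x)) := by linarith
  have h4 := mul_le_mul_of_nonneg_left h3 hs1
  have h5 := mul_le_mul_of_nonneg_left (h x w) hs0.le
  have h6 := congrArg (· * ((S.E K *ᵥ x) ⬝ᵥ (S.E K *ᵥ x))) hbal
  simp only [quadForm_matrix_add, quadForm_matrix_smul]
  linarith

theorem quadForm_ricSol_descent (hR : S.R.PosDef) (hγ : 0 < S.γ) (hK : K ∈ S.feasible)
    {N : Matrix (Fin d) (Fin d) ℝ} {c : ℝ} (hc : 0 < c)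
    (hN : IsDescentPreconditioner (S.hess (S.ricSol K)) N c) (x : Fin m → ℝ) :
    quadForm (S.ricSol (K - N * S.E K)) x + c * ((S.E K *ᵥ x) ⬝ᵥ (S.E K *ᵥ x)) ≤
      quadForm (S.ricSol K) x := by
  obtain ⟨hP, -, hΛ, -⟩ :=
    (isStabilizingSolution_iff hγ).1 (isStabilizingSolution_ricSol hR hγ hK)
  have hst := isStabilizingSolution_ricSol hR hγ (sub_mul_mem_feasible hR hγ hK hc hN)
  obtain ⟨hP', hfix', -, -⟩ := (isStabilizingSolution_iff hγ).1 hst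
  have hdesc := quadForm_ricOp_descent hR hγ hK hN
  have hle := hst.quadForm_le hγ hP.isSymm hΛ fun y => by
    have := mul_nonneg hc.le (dotProduct_self_nonneg (S.E K *ᵥ y))
    linarith [hdesc y]
  have h1 := quadForm_tilde_mono hP'.isSymm hP.isSymm hΛ hle
    (S.closedLoop (K - N * S.E K) *ᵥ x)
  have h2 := hdesc x
  rw [quadForm_ricOp] at h2
  have h3 := quadForm_ricOp (S := S) (K - N * S.E K) (S.ricSol (K - N * S.E K)) x
  rw [hfix'] at h3
  linarith

/-! ### The natural policy gradient and Gauss-Newton preconditioners -/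

theorem isDescentPreconditioner_smul_one {H : Matrix (Fin d) (Fin d) ℝ} {h η : ℝ}
    (hH : ∀ y, quadForm H y ≤ h * (y ⬝ᵥ y)) (hη : 0 < η) (hηh : 2 * η * h ≤ 1) :
    IsDescentPreconditioner H ((2 * η) • 1) (2 * η) := fun y => by
  have h1 := mul_le_mul_of_nonneg_right hηh (dotProduct_self_nonneg y)
  have h2 := mul_le_mul_of_nonneg_left (hH y) (by positivity : 0 ≤ (2 * η) ^ 2)
  rw [smul_mulVec, one_mulVec, dotProduct_smul, quadForm_smul, smul_eq_mul]
  nlinarith [mul_le_mul_of_nonneg_left h1 (by positivity : 0 ≤ 2 * η)]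

theorem dotProduct_self_le_of_quadForm_le {H : Matrix (Fin d) (Fin d) ℝ} (hH : H.PosDef) {h : ℝ}
    (hh : 0 < h) (hle : ∀ y, quadForm H y ≤ h * (y ⬝ᵥ y)) (y : Fin d → ℝ) :
    y ⬝ᵥ y ≤ h * (y ⬝ᵥ H⁻¹ *ᵥ y) := by
  set u := H⁻¹ *ᵥ y with hu
  have hHu : H *ᵥ u = y := by
    rw [hu, mulVec_mulVec, mul_nonsing_inv _ ((isUnit_iff_isUnit_det _).1 hH.isUnit), one_mulVec]
  -- expand the nonnegative form at `u - h⁻¹ y`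
  have h1 := hH.posSemidef.quadForm_nonneg (u - h⁻¹ • y)
  rw [quadForm_sub hH.isSymm, quadForm_smul, mulVec_smul, dotProduct_smul,
    hH.isSymm.dotProduct_mulVec_comm, hHu, smul_eq_mul] at h1
  have h2 : quadForm H u = y ⬝ᵥ u := by rw [quadForm, hHu, dotProduct_comm]
  have h3 := mul_le_mul_of_nonneg_left (hle y) (by positivity : 0 ≤ h⁻¹ ^ 2)
  have h4 : h⁻¹ ^ 2 * (h * (y ⬝ᵥ y)) = h⁻¹ * (y ⬝ᵥ y) := by field_simp
  rw [← inv_mul_le_iff₀ hh]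
  linarith

theorem isDescentPreconditioner_inv {H : Matrix (Fin d) (Fin d) ℝ} (hH : H.PosDef) {h η : ℝ}
    (hh : 0 < h) (hle : ∀ y, quadForm H y ≤ h * (y ⬝ᵥ y)) (hη : 0 < η) (hη2 : η ≤ 1 / 2) :
    IsDescentPreconditioner H ((2 * η) • H⁻¹) (2 * η * h⁻¹) := fun y => by
  have h1 := dotProduct_self_le_of_quadForm_le hH hh hle y
  have h2 : quadForm H (H⁻¹ *ᵥ y) = y ⬝ᵥ H⁻¹ *ᵥ y := by
    rw [quadForm, mulVec_mulVec, mul_nonsing_inv _ ((isUnit_iff_isUnit_det _).1 hH.isUnit),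
      one_mulVec, dotProduct_comm]
  have h3 : 0 ≤ y ⬝ᵥ H⁻¹ *ᵥ y := hH.inv.posSemidef.quadForm_nonneg y
  rw [← inv_mul_le_iff₀ hh] at h1
  rw [smul_mulVec, dotProduct_smul, quadForm_smul, h2, smul_eq_mul]
  have h4 := mul_le_mul_of_nonneg_left h1 (by positivity : 0 ≤ 2 * η)
  nlinarith [mul_nonneg (mul_nonneg hη.le (by linarith : 0 ≤ 1 - 2 * η)) h3]

end MixedDesign

namespace MixedDesign

variable {m d n l : ℕ} {S : MixedDesign m d n l}

/-! ### Convergence of policy improvement -/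

theorem frobSq_eq_sum {p q : ℕ} (M : Matrix (Fin p) (Fin q) ℝ) :
    frobSq M = ∑ j, (M *ᵥ Pi.single j 1) ⬝ᵥ (M *ᵥ Pi.single j 1) := by
  rw [frobSq, Finset.sum_comm]
  simp [dotProduct, pow_two]

theorem sq_apply_le_frobSq {p q : ℕ} (M : Matrix (Fin p) (Fin q) ℝ) (i : Fin p) (j : Fin q) :
    M i j ^ 2 ≤ frobSq M :=
  (Finset.single_le_sum (f := fun j => M i j ^ 2) (fun _ _ => sq_nonneg _)
    (Finset.mem_univ j)).trans
    (Finset.single_le_sum (f := fun i => ∑ j, M i j ^ 2)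
      (fun _ _ => Finset.sum_nonneg fun _ _ => sq_nonneg _) (Finset.mem_univ i))

/-- A sequence of feasible gains along which the Riccati solutions decrease at least by
`c E_Kᵀ E_K`. -/
structure IsDescentSequence (S : MixedDesign m d n l) (K : ℕ → Matrix (Fin d) (Fin m) ℝ) (c : ℝ) :
    Prop where
  pos : 0 < c
  feasible : ∀ k, K k ∈ S.feasible
  descent : ∀ k x, quadForm (S.ricSol (K (k + 1))) x +
    c * ((S.E (K k) *ᵥ x) ⬝ᵥ (S.E (K k) *ᵥ x)) ≤ quadForm (S.ricSol (K k)) x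

variable {K : ℕ → Matrix (Fin d) (Fin m) ℝ} {c : ℝ}

theorem IsDescentSequence.ricSol_antitone (h : S.IsDescentSequence K c) (x : Fin m → ℝ) (k : ℕ) :
    quadForm (S.ricSol (K (k + 1))) x ≤ quadForm (S.ricSol (K k)) x := by
  have := mul_nonneg h.pos.le (dotProduct_self_nonneg (S.E (K k) *ᵥ x))
  linarith [h.descent k x]

theorem IsDescentSequence.sum_frobSq_le (hR : S.R.PosDef) (hγ : 0 < S.γ)
    (h : S.IsDescentSequence K c) (N : ℕ) : ∑ k ∈ Finset.range N, frobSq (S.E (K k)) ≤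
      c⁻¹ * ∑ j, quadForm (S.ricSol (K 0)) (Pi.single j 1) := by
  have hP : ∀ k, (S.ricSol (K k)).PosSemidef := fun k =>
    (isStabilizingSolution_ricSol hR hγ (h.feasible k)).posSemidef
  have tele : ∀ (x : Fin m → ℝ) (N : ℕ), quadForm (S.ricSol (K N)) x +
      c * ∑ k ∈ Finset.range N, (S.E (K k) *ᵥ x) ⬝ᵥ (S.E (K k) *ᵥ x) ≤
        quadForm (S.ricSol (K 0)) x := by
    intro x N
    induction N with
    | zero => simp
    | succ N ih =>
      rw [Finset.sum_range_succ, mul_add]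
      linarith [h.descent N x]
  simp only [frobSq_eq_sum]
  rw [Finset.sum_comm, Finset.mul_sum]
  refine Finset.sum_le_sum fun j _ => ?_
  rw [le_inv_mul_iff₀ h.pos]
  linarith [tele (Pi.single j 1) N, (hP N).quadForm_nonneg (Pi.single j 1)]

theorem IsDescentSequence.tendsto_E (hR : S.R.PosDef) (hγ : 0 < S.γ)
    (h : S.IsDescentSequence K c) :
    Filter.Tendsto (fun k => S.E (K k)) Filter.atTop (nhds 0) := by
  have hnn : ∀ k, 0 ≤ frobSq (S.E (K k)) := fun k =>
    Finset.sum_nonneg fun _ _ => Finset.sum_nonneg fun _ _ => sq_nonneg _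
  have h0 := (summable_of_sum_range_le hnn (h.sum_frobSq_le hR hγ)).tendsto_atTop_zero
  refine tendsto_pi_nhds.2 fun i => tendsto_pi_nhds.2 fun j => ?_
  have h1 : Filter.Tendsto (fun k => S.E (K k) i j ^ 2) Filter.atTop (nhds 0) :=
    squeeze_zero (fun _ => sq_nonneg _) (fun k => sq_apply_le_frobSq _ i j) h0
  have h2 := h1.sqrt
  simp only [Real.sqrt_sq_eq_abs, Real.sqrt_zero] at h2
  exact (tendsto_zero_iff_abs_tendsto_zero _).2 h2

theorem gain_eq_inv_hess_mul (P : Matrix (Fin m) (Fin m) ℝ) :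
    S.gain P = (S.hess P)⁻¹ * (S.Bᵀ * S.tilde P * S.A) := by
  simp only [gain, Matrix.mul_assoc]

/-- The limit of a descent sequence solves the Riccati equation of its own gain, and its
worst-case closed loop, being a limit of stable ones, has no eigenvalue outside the closed unit
disc. -/
theorem IsDescentSequence.exists_limit (hR : S.R.PosDef) (hγ : 0 < S.γ)
    (h : S.IsDescentSequence K c) : ∃ P : Matrix (Fin m) (Fin m) ℝ,
      P.PosSemidef ∧ (S.slack P).PosDef ∧ (∀ x k, quadForm P x ≤ quadForm (S.ricSol (K k)) x) ∧
      Filter.Tendsto (fun k => S.ricSol (K k)) Filter.atTop (nhds P) ∧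
      Filter.Tendsto K Filter.atTop (nhds (S.gain P)) ∧ S.ricOp (S.gain P) P = P ∧
      ∀ (z : ℂ) (v : Fin m → ℂ), v ≠ 0 →
        toComplex (S.worstLoop (S.gain P) P) *ᵥ v = z • v → ‖z‖ ≤ 1 := by
  have hst := fun k => (isStabilizingSolution_iff hγ).1
    (isStabilizingSolution_ricSol hR hγ (h.feasible k))
  obtain ⟨P, hP, hlim, hle⟩ :=
    exists_tendsto_of_antitone_quadForm (fun k => (hst k).1) h.ricSol_antitone
  have hΛ : (S.slack P).PosDef :=
    posDef_slack_of_le (hst 0).2.2.1 hP.isSymm fun x => hle x 0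
  have hT := tendsto_tilde hlim hΛ
  have hH : Filter.Tendsto (fun k => S.hess (S.ricSol (K k))) Filter.atTop (nhds (S.hess P)) :=
    tendsto_const_nhds.add (tendsto_matrix_mul (tendsto_matrix_mul tendsto_const_nhds hT)
      tendsto_const_nhds)
  have hHinv := tendsto_inv_of_isUnit hH (hess_posDef hR hP hΛ).isUnit
  have hK : Filter.Tendsto K Filter.atTop (nhds (S.gain P)) := by
    have h1 : ∀ k, (S.hess (S.ricSol (K k)))⁻¹ *
        (S.E (K k) + S.Bᵀ * S.tilde (S.ricSol (K k)) * S.A) = K k := fun k => by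
      have hu := (isUnit_iff_isUnit_det _).1 (hess_posDef hR (hst k).1 (hst k).2.2.1).isUnit
      rw [E, sub_add_cancel, ← Matrix.mul_assoc, nonsing_inv_mul _ hu, Matrix.one_mul]
    have h2 := tendsto_matrix_mul hHinv ((h.tendsto_E hR hγ).add (tendsto_matrix_mul
      (tendsto_matrix_mul (tendsto_const_nhds (x := S.Bᵀ)) hT) (tendsto_const_nhds (x := S.A))))
    rw [zero_add, ← gain_eq_inv_hess_mul] at h2
    exact h2.congr h1
  refine ⟨P, hP, hΛ, hle, hlim, hK, ?_, fun z v hv hz => ?_⟩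
  · refine tendsto_nhds_unique (tendsto_ricOp hK hlim hΛ) (hlim.congr fun k => ?_)
    exact (hst k).2.1.symm
  · refine norm_eigenvalue_le_one_of_tendsto (fun k => (hst k).2.2.2) ?_ hv hz
    have hcl : Continuous S.closedLoop := by unfold closedLoop; fun_prop
    exact tendsto_matrix_mul (tendsto_amplify hlim hΛ) ((hcl.tendsto _).comp hK)

/-! ### Uniqueness of the optimal Riccati solution -/

variable {P X Y : Matrix (Fin m) (Fin m) ℝ}

variable (S) in
/-- The indefinite weight `B R⁻¹ Bᵀ - γ⁻² D Dᵀ` of the game Riccati equation. -/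
noncomputable def gameWeight : Matrix (Fin m) (Fin m) ℝ :=
  S.B * S.R⁻¹ * S.Bᵀ - (S.γ ^ 2)⁻¹ • (S.D * S.Dᵀ)

theorem gameWeight_isSymm (hR : S.R.PosDef) : (S.gameWeight).IsSymm := by
  have h1 : (S.R⁻¹)ᵀ = S.R⁻¹ := by rw [transpose_nonsing_inv, hR.isSymm.eq]
  simp [gameWeight, IsSymm, h1, Matrix.mul_assoc]

/-- At a fixed point of policy improvement, the Riccati equation takes the Hamiltonian form
`X = Cᵀ C + Aᵀ X M`, `A = M + (B R⁻¹ Bᵀ - γ⁻² D Dᵀ) X M`, with `M` the worst-case closed loop. -/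
theorem hamiltonian_form (hR : S.R.PosDef) (hγ : 0 < S.γ) (hX : X.PosSemidef)
    (hΛ : (S.slack X).PosDef) (hfix : S.ricOp (S.gain X) X = X) :
    X = S.Cᵀ * S.C + S.Aᵀ * X * S.worstLoop (S.gain X) X ∧
      S.A = S.worstLoop (S.gain X) X + S.gameWeight * X * S.worstLoop (S.gain X) X := by
  set L := S.gain X with hL
  have hTM : X * S.worstLoop L X = S.tilde X * S.closedLoop L := by
    rw [worstLoop, ← Matrix.mul_assoc, ← tilde_eq_mul_amplify]
  have hgain : S.hess X * L = S.Bᵀ * S.tilde X * S.A := by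
    rw [hL, gain_eq_inv_hess_mul, ← Matrix.mul_assoc, mul_nonsing_inv _
      ((isUnit_iff_isUnit_det _).1 (hess_posDef hR hX hΛ).isUnit), Matrix.one_mul]
  have hRL : S.R * L = S.Bᵀ * (S.tilde X * S.closedLoop L) := by
    rw [hess, Matrix.add_mul, ← eq_sub_iff_add_eq] at hgain
    rw [hgain, closedLoop]
    simp only [Matrix.mul_sub, Matrix.mul_assoc]
  constructor
  · rw [Matrix.mul_assoc, hTM]
    conv_lhs => rw [← hfix]
    rw [ricOp, weight, Matrix.mul_assoc Lᵀ, hRL, Matrix.mul_assoc (S.closedLoop L)ᵀ]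
    nth_rw 1 [closedLoop]
    rw [transpose_sub, transpose_mul, Matrix.sub_mul, Matrix.mul_assoc Lᵀ]
    abel
  · have hBL : S.B * L = S.B * S.R⁻¹ * S.Bᵀ * (S.tilde X * S.closedLoop L) := by
      have hu := (isUnit_iff_isUnit_det _).1 hR.isUnit
      rw [Matrix.mul_assoc (S.B * S.R⁻¹), ← hRL, Matrix.mul_assoc, ← Matrix.mul_assoc S.R⁻¹,
        nonsing_inv_mul _ hu, Matrix.one_mul]
    have hM : S.worstLoop L X = S.closedLoop L +
        (S.γ ^ 2)⁻¹ • (S.D * S.Dᵀ) * (S.tilde X * S.closedLoop L) := by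
      rw [worstLoop, amplify, worst_eq hγ hΛ, Matrix.add_mul, Matrix.one_mul]
      simp only [Matrix.mul_smul, Matrix.smul_mul, Matrix.mul_assoc]
    have hA : S.A = S.closedLoop L + S.B * L := by rw [closedLoop, sub_add_cancel]
    rw [Matrix.mul_assoc, hTM, gameWeight, Matrix.sub_mul, ← hBL]
    conv_rhs => rw [hM]
    conv_lhs => rw [hA]
    abel

/-- The difference of two solutions of the game Riccati equation solves a Stein equation between
their closed loops. -/
theorem eq_of_fixedPoints (hR : S.R.PosDef) (hγ : 0 < S.γ) (hX : X.PosSemidef)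
    (hΛX : (S.slack X).PosDef) (hfixX : S.ricOp (S.gain X) X = X) (hY : Y.PosSemidef)
    (hΛY : (S.slack Y).PosDef) (hfixY : S.ricOp (S.gain Y) Y = Y)
    (hstX : specRad (S.worstLoop (S.gain X) X) < 1)
    (hstY : ∀ (z : ℂ) (v : Fin m → ℂ), v ≠ 0 →
      toComplex (S.worstLoop (S.gain Y) Y) *ᵥ v = z • v → ‖z‖ ≤ 1) : X = Y := by
  obtain ⟨hX1, hX2⟩ := hamiltonian_form hR hγ hX hΛX hfixX
  obtain ⟨hY1, hY2⟩ := hamiltonian_form hR hγ hY hΛY hfixY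
  set M := S.worstLoop (S.gain X) X
  set N := S.worstLoop (S.gain Y) Y
  have hΓ := (gameWeight_isSymm hR).eq
  set Γ := S.gameWeight
  have hA' : S.Aᵀ = Nᵀ + Nᵀ * Y * Γ := by
    conv_lhs => rw [hY2]
    rw [transpose_add, transpose_mul, transpose_mul, hΓ, hY.isSymm.eq, Matrix.mul_assoc]
  have hY1' : Y = S.Cᵀ * S.C + Nᵀ * Y * S.A := by
    conv_lhs => rw [← hY.isSymm.eq, hY1]
    simp only [transpose_add, transpose_mul, transpose_transpose, hY.isSymm.eq, Matrix.mul_assoc]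
  rw [← sub_eq_zero]
  refine eq_zero_of_eq_transpose_mul_mul hstX hstY ?_
  calc X - Y = S.Aᵀ * X * M - Nᵀ * Y * S.A := by
        conv_lhs => rw [hX1, hY1']
        abel
    _ = (Nᵀ + Nᵀ * Y * Γ) * X * M - Nᵀ * Y * (M + Γ * X * M) := by
        rw [hA']; conv_lhs => rw [hX2]
    _ = Nᵀ * (X - Y) * M := by noncomm_ring

theorem IsDescentSequence.limit_eq_ricSol (hR : S.R.PosDef) (hγ : 0 < S.γ)
    (h : S.IsDescentSequence K c) {G : Matrix (Fin d) (Fin m) ℝ} (hG : G ∈ S.feasible)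
    (hfix : G = S.gain (S.ricSol G)) :
    (∀ x, quadForm (S.ricSol G) x ≤ quadForm (S.ricSol (K 0)) x) ∧
      Filter.Tendsto K Filter.atTop (nhds G) := by
  obtain ⟨P, hP, hΛ, hle, -, hK, hric, hev⟩ := h.exists_limit hR hγ
  obtain ⟨hX, hricX, hΛX, hstX⟩ :=
    (isStabilizingSolution_iff hγ).1 (isStabilizingSolution_ricSol hR hγ hG)
  nth_rw 1 [hfix] at hricX hstX
  have heq := eq_of_fixedPoints hR hγ hX hΛX hricX hP hΛ hric hstX hev
  exact ⟨fun x => by rw [heq]; exact hle x 0, by rw [hfix, heq]; exact hK⟩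

/-! ### The two iterations are descent sequences -/

theorem isDescentSequence_of_step (hR : S.R.PosDef) (hγ : 0 < S.γ) (hK₀ : K 0 ∈ S.feasible)
    (hc : 0 < c)
    (hstep : ∀ k, K k ∈ S.feasible →
      (∀ y, quadForm (S.hess (S.ricSol (K k))) y ≤
        opNorm (S.hess (S.ricSol (K 0))) * (y ⬝ᵥ y)) →
      ∃ N, IsDescentPreconditioner (S.hess (S.ricSol (K k))) N c ∧
        K (k + 1) = K k - N * S.E (K k)) : S.IsDescentSequence K c := by
  have hbound : ∀ k, K k ∈ S.feasible →
      (∀ x, quadForm (S.ricSol (K k)) x ≤ quadForm (S.ricSol (K 0)) x) →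
      ∀ y, quadForm (S.hess (S.ricSol (K k))) y ≤
        opNorm (S.hess (S.ricSol (K 0))) * (y ⬝ᵥ y) := by
    intro k hk hle y
    obtain ⟨h1, -, -, -⟩ :=
      (isStabilizingSolution_iff hγ).1 (isStabilizingSolution_ricSol hR hγ hk)
    obtain ⟨h2, -, h3, -⟩ :=
      (isStabilizingSolution_iff hγ).1 (isStabilizingSolution_ricSol hR hγ hK₀)
    refine le_trans ?_ (quadForm_le_opNorm _ y)
    rw [quadForm_hess, quadForm_hess]
    linarith [quadForm_tilde_mono h1.isSymm h2.isSymm h3 hle (S.B *ᵥ y)]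
  have hdesc : ∀ k, K k ∈ S.feasible →
      (∀ x, quadForm (S.ricSol (K k)) x ≤ quadForm (S.ricSol (K 0)) x) →
      K (k + 1) ∈ S.feasible ∧ ∀ x, quadForm (S.ricSol (K (k + 1))) x +
        c * ((S.E (K k) *ᵥ x) ⬝ᵥ (S.E (K k) *ᵥ x)) ≤ quadForm (S.ricSol (K k)) x := by
    intro k hk hle
    obtain ⟨N, hN, hKN⟩ := hstep k hk (hbound k hk hle)
    rw [hKN]
    exact ⟨sub_mul_mem_feasible hR hγ hk hc hN, quadForm_ricSol_descent hR hγ hk hc hN⟩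
  have hall : ∀ k, K k ∈ S.feasible ∧
      ∀ x, quadForm (S.ricSol (K k)) x ≤ quadForm (S.ricSol (K 0)) x := by
    intro k
    induction k with
    | zero => exact ⟨hK₀, fun _ => le_rfl⟩
    | succ k ih =>
      obtain ⟨h1, h2⟩ := hdesc k ih.1 ih.2
      refine ⟨h1, fun x => ?_⟩
      have := mul_nonneg hc.le (dotProduct_self_nonneg (S.E (K k) *ᵥ x))
      linarith [h2 x, ih.2 x]
  exact ⟨hc, fun k => (hall k).1, fun k => (hdesc k (hall k).1 (hall k).2).2⟩

theorem isDescentSequence_npg (hR : S.R.PosDef) (hγ : 0 < S.γ) (hK₀ : K 0 ∈ S.feasible) {η : ℝ}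
    (hη : 0 < η) (hη2 : 2 * η * opNorm (S.hess (S.ricSol (K 0))) ≤ 1)
    (hK : ∀ k, K (k + 1) = S.npgStep η (K k)) : S.IsDescentSequence K (2 * η) :=
  isDescentSequence_of_step hR hγ hK₀ (by positivity) fun k _ hbd =>
    ⟨_, isDescentPreconditioner_smul_one hbd hη hη2, by
      rw [hK, npgStep, smul_mul, Matrix.one_mul]⟩

theorem isDescentSequence_gn (hR : S.R.PosDef) (hγ : 0 < S.γ) (hK₀ : K 0 ∈ S.feasible) {η : ℝ}
    (hη : 0 < η) (hη2 : η ≤ 1 / 2) (hK : ∀ k, K (k + 1) = S.gnStep η (K k)) :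
    S.IsDescentSequence K (2 * η * (opNorm (S.hess (S.ricSol (K 0))) + 1)⁻¹) := by
  -- the operator norm vanishes when `d = 0`; adding `1` avoids the division by zero
  have hh : 0 < opNorm (S.hess (S.ricSol (K 0))) + 1 := by
    linarith [opNorm_nonneg (S.hess (S.ricSol (K 0)))]
  refine isDescentSequence_of_step hR hγ hK₀ (by positivity) fun k hk hbd => ?_
  obtain ⟨hP, -, hΛ, -⟩ :=
    (isStabilizingSolution_iff hγ).1 (isStabilizingSolution_ricSol hR hγ hk)
  refine ⟨_, isDescentPreconditioner_inv (hess_posDef hR hP hΛ) hh (fun y => ?_) hη hη2, ?_⟩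
  · linarith [hbd y, dotProduct_self_nonneg y]
  · rw [hK, gnStep, smul_mul]

/-- A feasible fixed point `G` has the smallest Riccati solution: policy iteration started from
any feasible gain decreases to `P_G`. -/
theorem quadForm_ricSol_le_of_fixedPoint (hR : S.R.PosDef) (hγ : 0 < S.γ)
    {G G' : Matrix (Fin d) (Fin m) ℝ} (hG : G ∈ S.feasible) (hfix : G = S.gain (S.ricSol G))
    (hG' : G' ∈ S.feasible) (x : Fin m → ℝ) :
    quadForm (S.ricSol G) x ≤ quadForm (S.ricSol G') x := by
  have h := isDescentSequence_gn (K := fun k => (S.gnStep (1 / 2))^[k] G') hR hγ hG'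
    (by norm_num) le_rfl fun k => Function.iterate_succ_apply' _ _ _
  exact (h.limit_eq_ricSol hR hγ hG hfix).1 x

/-! ### Monotonicity of the costs -/

theorem trace_le_trace_of_quadForm_le {a : Type*} [Fintype a] [DecidableEq a] {M N : Matrix a a ℝ}
    (h : ∀ x, quadForm M x ≤ quadForm N x) : M.trace ≤ N.trace :=
  Finset.sum_le_sum fun i _ => by simpa [quadForm] using h (Pi.single i 1)

theorem one_le_det_one_add {a : Type*} [Fintype a] [DecidableEq a] {M : Matrix a a ℝ}
    (hM : M.PosSemidef) : 1 ≤ (1 + M).det := by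
  have hH : (1 + M).IsHermitian := (PosSemidef.one.add hM).isHermitian
  rw [hH.det_eq_prod_eigenvalues]
  have h1 : ∀ i, 1 ≤ hH.eigenvalues i := by
    intro i
    set v : a → ℝ := (hH.eigenvectorBasis i).ofLp with hv
    have h2 : (1 + M) *ᵥ v = hH.eigenvalues i • v := hH.mulVec_eigenvectorBasis i
    have h3 : v ⬝ᵥ v = 1 := by
      have h4 := hH.eigenvectorBasis.norm_eq_one i
      have h5 := EuclideanSpace.norm_sq_eq (hH.eigenvectorBasis i)
      rw [h4] at h5
      simp only [Real.norm_eq_abs, sq_abs] at h5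
      rw [dotProduct, ← one_pow 2, h5]
      exact Finset.sum_congr rfl fun j _ => (pow_two _).symm
    have h6 : quadForm (1 + M) v = hH.eigenvalues i := by
      rw [quadForm, h2, dotProduct_smul, h3, smul_eq_mul, mul_one]
    rw [← h6, quadForm_matrix_add, quadForm_one, h3]
    linarith [hM.quadForm_nonneg v]
  have h2 : ∏ _i : a, (1 : ℝ) ≤ ∏ i, hH.eigenvalues i :=
    Finset.prod_le_prod (fun _ _ => zero_le_one) fun i _ => h1 i
  simpa using h2

theorem det_le_det_of_quadForm_le {a : Type*} [Fintype a] [DecidableEq a] {M N : Matrix a a ℝ}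
    (hM : M.PosDef) (hN : N.IsSymm) (h : ∀ x, quadForm M x ≤ quadForm N x) : M.det ≤ N.det := by
  obtain ⟨Y, hY⟩ := hM.posSemidef.exists_eq_mul_transpose
  have hdet : M.det = Y.det * Y.det := by rw [hY, det_mul, det_transpose]
  have hYdet : IsUnit Y.det := by
    refine isUnit_iff_ne_zero.2 fun h0 => hM.det_pos.ne' ?_
    rw [hdet, h0, mul_zero]
  have hYdet' : IsUnit Yᵀ.det := by rwa [det_transpose]
  -- `N = Y (1 + C) Yᵀ` with `C` positive semidefinite
  set C := Y⁻¹ * (N - M) * (Y⁻¹)ᵀ with hC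
  have hCpos : C.PosSemidef := by
    have h1 : (N - M).PosSemidef := posSemidef_iff_quadForm.2 ⟨hN.sub hM.isSymm, fun x => by
      rw [quadForm_matrix_sub]; linarith [h x]⟩
    have h2 := h1.mul_mul_conjTranspose_same Y⁻¹
    rwa [conjTranspose_eq_transpose_of_trivial] at h2
  have hNC : N = Y * (1 + C) * Yᵀ := by
    rw [Matrix.mul_add, Matrix.add_mul, Matrix.mul_one, ← hY, hC, ← Matrix.mul_assoc,
      ← Matrix.mul_assoc, mul_nonsing_inv _ hYdet, Matrix.one_mul, transpose_nonsing_inv,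
      Matrix.mul_assoc, nonsing_inv_mul _ hYdet', Matrix.mul_one, add_sub_cancel]
  rw [hNC, det_mul, det_mul, det_transpose, hdet]
  nlinarith [one_le_det_one_add hCpos, mul_self_nonneg Y.det]

theorem trace_mul_D_le (h : ∀ x, quadForm X x ≤ quadForm Y x) :
    (S.Dᵀ * X * S.D).trace ≤ (S.Dᵀ * Y * S.D).trace :=
  trace_le_trace_of_quadForm_le fun w => by rw [quadForm_congr, quadForm_congr]; exact h _

theorem costLogDet_eq (G : Matrix (Fin d) (Fin m) ℝ) : S.costLogDet G = -S.γ ^ 2 * Real.log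
    ((1 : Matrix (Fin n) (Fin n) ℝ) - (S.γ ^ 2)⁻¹ • (S.Dᵀ * S.ricSol G * S.D)).det := by
  rw [costLogDet, ← smul_mul, det_one_sub_mul_comm, Matrix.mul_smul, ← Matrix.mul_assoc]

theorem costTraceInv_eq (hγ : 0 < S.γ) {G : Matrix (Fin d) (Fin m) ℝ}
    (hP : (S.ricSol G).PosSemidef) (hΛ : (S.slack (S.ricSol G)).PosDef) :
    S.costTraceInv G = (S.Dᵀ * S.tilde (S.ricSol G) * S.D).trace := by
  have h := inv_transpose_eq_amplify hγ hP.isSymm hΛ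
  rw [transpose_nonsing_inv, transpose_sub, transpose_one, transpose_smul, transpose_mul,
    transpose_mul, transpose_transpose, hP.isSymm.eq, ← Matrix.mul_assoc] at h
  rw [costTraceInv, h, Matrix.mul_assoc S.Dᵀ, ← tilde_eq_mul_amplify]

theorem isGlobalOptimum_of_fixedPoint (hR : S.R.PosDef) (hγ : 0 < S.γ)
    {G : Matrix (Fin d) (Fin m) ℝ} (hG : G ∈ S.feasible) (hfix : G = S.gain (S.ricSol G)) :
    S.IsGlobalOptimum G := by
  have hle := fun G' hG' => quadForm_ricSol_le_of_fixedPoint (G' := G') hR hγ hG hfix hG'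
  have hst := fun G' (hG' : G' ∈ S.feasible) =>
    (isStabilizingSolution_iff hγ).1 (isStabilizingSolution_ricSol hR hγ hG')
  obtain ⟨hP, -, hΛ, -⟩ := hst G hG
  refine ⟨hG, fun G' hG' => ?_, fun G' hG' => ?_, fun G' hG' => ?_⟩
  · change S.costTrace G ≤ S.costTrace G'
    rw [costTrace, costTrace, trace_mul_comm, trace_mul_comm _ S.Dᵀ, ← Matrix.mul_assoc,
      ← Matrix.mul_assoc]
    exact trace_mul_D_le (hle G' hG')
  · change S.costLogDet G ≤ S.costLogDet G'
    obtain ⟨hP', -, hΛ', -⟩ := hst G' hG'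
    have h1 := (posDef_slack_iff hγ).1 hΛ'
    have h2 := (posDef_slack_iff hγ).1 hΛ
    rw [costLogDet_eq, costLogDet_eq, neg_mul, neg_mul, neg_le_neg_iff]
    refine mul_le_mul_of_nonneg_left (Real.log_le_log h1.det_pos
      (det_le_det_of_quadForm_le h1 h2.isSymm fun w => ?_)) (by positivity)
    rw [quadForm_matrix_sub, quadForm_matrix_sub, quadForm_matrix_smul, quadForm_matrix_smul,
      quadForm_congr, quadForm_congr]
    have := mul_le_mul_of_nonneg_left (hle G' hG' (S.D *ᵥ w))
      (by positivity : 0 ≤ (S.γ ^ 2)⁻¹)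
    linarith
  · change S.costTraceInv G ≤ S.costTraceInv G'
    obtain ⟨hP', -, hΛ', -⟩ := hst G' hG'
    rw [costTraceInv_eq hγ hP hΛ, costTraceInv_eq hγ hP' hΛ']
    exact trace_mul_D_le (quadForm_tilde_mono hP.isSymm hP'.isSymm hΛ' (hle G' hG'))

end MixedDesign

theorem theorem4p2 {m d n l : ℕ} (S : MixedDesign m d n l) (hR : S.R.PosDef) (hγ : 0 < S.γ)
    (K : ℕ → Matrix (Fin d) (Fin m) ℝ) (hK₀ : K 0 ∈ S.feasible) (η : ℝ) (hη : 0 < η)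
    (hK : (2 * η * opNorm (S.hess (S.ricSol (K 0))) ≤ 1 ∧ ∀ k, K (k + 1) = S.npgStep η (K k)) ∨
      (η ≤ 1 / 2 ∧ ∀ k, K (k + 1) = S.gnStep η (K k))) :
    -- `P_K` is well defined on the feasible set
    (∀ K' ∈ S.feasible, ∃! P, S.IsStabilizingSolution K' P) ∧
    -- all iterates are feasible
    (∀ k, K k ∈ S.feasible) ∧
    -- the average of the squared Frobenius norms decays at rate `O(1/N)`
    (∃ c : ℝ, ∀ N : ℕ, 1 ≤ N →
      (1 / (N : ℝ)) * ∑ k ∈ Finset.range N, frobSq (S.E (K k)) ≤ c / N) ∧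
    -- the iterates converge
    (∃ P, Filter.Tendsto (fun k => S.ricSol (K k)) Filter.atTop (nhds P) ∧
      Filter.Tendsto K Filter.atTop (nhds (S.gain P)) ∧ S.Riccati (S.gain P) P) ∧
    -- the limit is the global optimum `K* = (R + Bᵀ P̃_{K*} B)⁻¹ Bᵀ P̃_{K*} A` (if it exists in `𝒦`)
    (∀ Kopt ∈ S.feasible, Kopt = S.gain (S.ricSol Kopt) →
      S.IsGlobalOptimum Kopt ∧ Filter.Tendsto K Filter.atTop (nhds Kopt)) := by
  obtain ⟨c, hc⟩ : ∃ c, S.IsDescentSequence K c := by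
    rcases hK with ⟨hη2, hK⟩ | ⟨hη2, hK⟩
    · exact ⟨_, MixedDesign.isDescentSequence_npg hR hγ hK₀ hη hη2 hK⟩
    · exact ⟨_, MixedDesign.isDescentSequence_gn hR hγ hK₀ hη hη2 hK⟩
  refine ⟨fun K' hK' => MixedDesign.existsUnique_isStabilizingSolution hR hγ hK', hc.feasible,
    ⟨c⁻¹ * ∑ j, quadForm (S.ricSol (K 0)) (Pi.single j 1), fun N _ => ?_⟩, ?_, fun Kopt hKopt hfix =>
      ⟨MixedDesign.isGlobalOptimum_of_fixedPoint hR hγ hKopt hfix,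
        (hc.limit_eq_ricSol hR hγ hKopt hfix).2⟩⟩
  · rw [one_div, div_eq_inv_mul]
    exact mul_le_mul_of_nonneg_left (hc.sum_frobSq_le hR hγ N) (by positivity)
  · obtain ⟨P, -, -, -, hP, hKP, hric, -⟩ := hc.exists_limit hR hγ
    exact ⟨P, hP, hKP, MixedDesign.riccati_iff.2 hric⟩
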